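/- All digraphs are finite, nonempty, without loops and without parallel arcs (2-cycles are allowed); cycles and paths are directed. A digraph is semicomplete if any two distinct vertices are joined by at least one arc. For a digraph $T$ with vertices $u_1,\dots,u_t$ ($t\ge 2$) and digraphs $H_1,\dots,H_t$, the composition $Q=T[H_1,\dots,H_t]$ is the digraph on the disjoint union of the sets $V(H_i)$ whose arcs are the arcs of every $H_i$ and all arcs $xy$ with $x\in V(H_i)$, $y\in V(H_j)$, $u_iu_j\in A(T)$; it is a semicomplete composition if $T$ is semicomplete. A digraph on $n$ vertices is Hamiltonian if it has a cycle through all its vertices, and pancyclic if it has a cycle of length $k$ for every $3\le k\le n$. For disjoint sets $A,B$ of vertices, $A\Rightarrow B$ means that there is an arc from every vertex of $A$ to every vertex of $B$ and no arc from $B$ to $A$. A digraph is triangular with a partition $\{V_0,V_1,V_2\}$ of its vertex set (into nonempty parts) if $V_0\Rightarrow V_1\Rightarrow V_2\Rightarrow V_0$. A set $S$ of vertices is independent if the induced subdigraph $Q[S]$ has no arcs. The length of a path is its number of arcs. Theorem. Let $Q=T[H_1,\dots,H_t]$ be a Hamiltonian semicomplete composition on $n\ge 4$ vertices, and suppose that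 $t\ge 3$ or some $H_i$ has an arc (that is, exclude only the case in which $t=2$ and $Q$ is bipartite with the two independent parts $V(H_1)$, $V(H_2)$). Then $Q$ is pancyclic if and only if it is not triangular with a partition $\{V_0,V_1,V_2\}$, two parts of which are independent, such that either $|V_0|=|V_1|=|V_2|$, or $n\ge 5$ and no $Q[V_i]$ ($i=0,1,2$) contains a path of length $2$. -/

import Mathlib

namespace Digraph

/-- No vertex has an arc to itself. (A Mathlib `Digraph` has no parallel arcs, but may have loops.) -/
def IsLoopless {V : Type*} (D : Digraph V) : Prop :=
  ∀ v, ¬ D.Adj v v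

/-- Between any two distinct vertices there is at least one arc. -/
def IsSemicomplete {V : Type*} (D : Digraph V) : Prop :=
  ∀ x y, x ≠ y → D.Adj x y ∨ D.Adj y x

/-- The composition `T[H₁, …, Hₜ]`, on the disjoint union of the vertex sets of the `Hᵢ`:
there is an arc from `⟨i, x⟩` to `⟨j, y⟩` iff `T` has the arc `i → j`, or `i = j` and `Hᵢ` has
the arc `x → y`. -/
def composition {ι : Type*} {V : ι → Type*} (T : Digraph ι) (H : ∀ i, Digraph (V i)) :
    Digraph (Σ i, V i) where
  Adj := Sigma.Lex T.Adj (fun i => (H i).Adj)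

/-- The vertices on `c`, taken in cyclic order, form a directed cycle of `D`. -/
def IsCycle {V : Type*} (D : Digraph V) (c : Cycle V) : Prop :=
  2 ≤ c.length ∧ c.Nodup ∧ c.Chain D.Adj

/-- `D` contains a directed cycle of length `k`. -/
def HasCycleOfLength {V : Type*} (D : Digraph V) (k : ℕ) : Prop :=
  ∃ c : Cycle V, D.IsCycle c ∧ c.length = k

/-- Some directed cycle of `D` contains all its vertices. -/
def IsHamiltonian {V : Type*} (D : Digraph V) : Prop :=
  ∃ c : Cycle V, D.IsCycle c ∧ ∀ v, v ∈ c

/-- `D` contains a cycle of each length from `3` up to the number of its vertices. -/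
def IsPancyclic {V : Type*} [Fintype V] (D : Digraph V) : Prop :=
  ∀ k, 3 ≤ k → k ≤ Fintype.card V → D.HasCycleOfLength k

/-- `A ⇒ B`: every vertex of `A` dominates every vertex of `B`, and no arc goes from `B` to `A`. -/
def StrictlyDominates {V : Type*} (D : Digraph V) (A B : Set V) : Prop :=
  ∀ a ∈ A, ∀ b ∈ B, D.Adj a b ∧ ¬ D.Adj b a

/-- `D` is triangular with the partition `{P 0, P 1, P 2}`: `P 0 ⇒ P 1 ⇒ P 2 ⇒ P 0`. -/
structure IsTriangularWith {V : Type*} (D : Digraph V) (P : Fin 3 → Set V) : Prop where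
  nonempty : ∀ i, (P i).Nonempty
  disjoint : ∀ i j, i ≠ j → Disjoint (P i) (P j)
  cover : ⋃ i, P i = Set.univ
  dom01 : D.StrictlyDominates (P 0) (P 1)
  dom12 : D.StrictlyDominates (P 1) (P 2)
  dom20 : D.StrictlyDominates (P 2) (P 0)

/-- The subdigraph of `D` induced by `S` has no arcs. -/
def IsIndependent {V : Type*} (D : Digraph V) (S : Set V) : Prop :=
  ∀ x ∈ S, ∀ y ∈ S, ¬ D.Adj x y

/-- The subdigraph of `D` induced by `S` contains a directed path of length `2`
(two arcs, three distinct vertices). -/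
def HasPathOfLengthTwoIn {V : Type*} (D : Digraph V) (S : Set V) : Prop :=
  ∃ x ∈ S, ∃ y ∈ S, ∃ z ∈ S, x ≠ y ∧ y ≠ z ∧ x ≠ z ∧ D.Adj x y ∧ D.Adj y z

end Digraph

/-!
The cycles of a digraph are handled as cyclic permutations of its vertices (`Digraph.CyclicOn`,
`Digraph.IsCyclePerm`), on which vertices are inserted and deleted by multiplication with a
transposition.

Arcs of a Hamiltonian cycle of `T[H₁, …, Hₜ]` that lie inside some `Hᵢ` can be contracted one at a
time (`IsCompositionOver.exists_contraction`). This gives all lengths down to that of a Hamiltonian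
cycle of a blow-up of `T`, in which every vertex `i` is replaced by an independent class, and leaves
the shorter cycles to be found.

If `T` has at least three vertices and is not triangular, the blow-up is pancyclic
(`hasCycleOfLength_blowUp`). Lengths up to the order of `T` come from Moon's theorem for strong
semicomplete digraphs (`IsStronglyConnected.exists_cyclicOn`). For the others, it suffices to delete
a vertex from a class of size at least two so that a Hamiltonian cycle survives, and to proceed by
induction. As `T` stays strong, a cycle factor can be merged into a single cycle
(`IsFactor.exists_isCycle`), so only cycle factors matter. If every such deletion destroys all of
them, Hall's theorem yields, for each class `v` of size at least two, a tight set `S` of classes, as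
large in total as its out-neighbourhood, with `v ∈ N⁺(S) \ S` (`IsFactor.exists_tight`). By
semicompleteness `S \ N⁺(S)` is a single class `p`; if `v` has maximum size, so has `p`, and
`N⁺(S) = (S \ {p}) ∪ {v}` (`exists_isTightExchange`). Applying this to `v` and then to `p` leaves
two possibilities: `T` is a triangle, which is excluded, or two classes of equal size form a digon
to which all others are attached in one direction (`IsDigonHub`), where all cycles can be written
down.

If the composition is triangular, or if `T` has two vertices, the short cycles are also explicit:
they go around a triangle or a digon, with detours along arcs inside the classes
(`IsCompositionOver.hasCycleOfLength_of_triangle`, `IsCompositionOver.hasCycleOfLength_of_two`). The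
lengths `3j + 1` need an arc inside a class, the lengths `3j + 2` two arcs in different classes or a
path of length two, and in the exceptional case counting vertices class by class shows that a length
is missing (`IsCompositionOver.not_isPancyclic`).
-/

section

open Equiv Equiv.Perm

/-! ### Directed cycles as cyclic permutations -/

/-- A relation holds along a cyclic list without repetitions iff it holds between each entry and
its image under the associated permutation. -/
theorem List.chain_coe_iff_formPerm {α : Type*} [DecidableEq α] {r : α → α → Prop} {l : List α}
    (hl : l.Nodup) : (l : Cycle α).Chain r ↔ ∀ x ∈ l, r x (l.formPerm x) := by
  rcases l with _ | ⟨a, l⟩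
  · simp
  rw [Cycle.chain_coe_cons, List.isChain_iff_getElem]
  have key : ∀ i (hi : i < (a :: l).length),
      (a :: l).formPerm (a :: l)[i] = (a :: (l ++ [a]))[i + 1]'(by simp at hi ⊢; omega) := by
    intro i hi
    rw [List.formPerm_apply_getElem _ hl]
    simp only [List.getElem_cons_succ]
    simp only [List.length_cons] at hi ⊢
    rcases Nat.lt_or_ge i l.length with h | h
    · simp [Nat.mod_eq_of_lt (Nat.succ_lt_succ h), List.getElem_append_left h]
    · obtain rfl : i = l.length := by omega
      simp
  have key2 : ∀ i (hi : i < (a :: l).length),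
      (a :: l)[i] = (a :: (l ++ [a]))[i]'(by simp at hi ⊢; omega) := by
    intro i hi
    have := List.getElem_append_left (as := a :: l) (bs := [a]) hi (h' := by simp at hi ⊢; omega)
    exact this.symm
  constructor
  · intro h x hx
    obtain ⟨i, hi, rfl⟩ := List.getElem_of_mem hx
    rw [key i hi, key2 i hi]
    exact h i (by simp at hi ⊢; omega)
  · intro h i hi
    have hi' : i < (a :: l).length := by simp at hi ⊢; omega
    have := h _ (List.getElem_mem hi')
    rwa [key i hi', key2 i hi'] at this

namespace Digraph

/-- `W` is the vertex set of a directed cycle of `D`; the cycle is encoded as the cyclic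
permutation with support `W` that sends each vertex to its successor. -/
def CyclicOn {V : Type*} [Fintype V] [DecidableEq V] (D : Digraph V) (W : Finset V) : Prop :=
  ∃ σ : Perm V, σ.IsCycle ∧ σ.support = W ∧ ∀ x ∈ W, D.Adj x (σ x)

theorem HasCycleOfLength.map {V V' : Type*} {D : Digraph V} {D' : Digraph V'} {f : V → V'} {k : ℕ}
    (h : D.HasCycleOfLength k) (hf : Function.Injective f)
    (hD : ∀ x y, D.Adj x y → D'.Adj (f x) (f y)) : D'.HasCycleOfLength k := by
  obtain ⟨e, ⟨h1, h2, h3⟩, rfl⟩ := h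
  have hlen : (e.map f).length = e.length := by
    induction e using Quotient.inductionOn' with
    | h l => exact List.length_map f
  refine ⟨e.map f, ⟨by rwa [hlen], ?_, (Cycle.chain_map f).2 (h3.imp hD)⟩, hlen⟩
  clear h1 h3 hlen
  induction e using Quotient.inductionOn' with
  | h l => exact List.Nodup.map hf h2

section

variable {V : Type*} [Fintype V] [DecidableEq V] {D : Digraph V}

theorem IsCycle.exists_perm {c : Cycle V} (hc : D.IsCycle c) :
    ∃ σ : Perm V, σ.IsCycle ∧ σ.support = c.toFinset ∧ ∀ x ∈ c, D.Adj x (σ x) := by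
  obtain ⟨h2, hn, hch⟩ := hc
  induction c using Quotient.inductionOn' with
  | h l =>
    have hn' : l.Nodup := hn
    exact ⟨l.formPerm, List.isCycle_formPerm hn' h2,
      List.support_formPerm_of_nodup l hn' (by rintro x rfl; simp at h2),
      (List.chain_coe_iff_formPerm hn').1 hch⟩

theorem hasCycleOfLength_iff {k : ℕ} :
    D.HasCycleOfLength k ↔ ∃ W : Finset V, W.card = k ∧ D.CyclicOn W := by
  constructor
  · rintro ⟨c, hc, rfl⟩
    obtain ⟨σ, h1, h2, h3⟩ := hc.exists_perm
    obtain ⟨-, hn, -⟩ := hc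
    refine ⟨c.toFinset, ?_, σ, h1, h2, ?_⟩ <;> clear h1 h2
    · induction c using Quotient.inductionOn' with
      | h l => exact List.toFinset_card_of_nodup hn
    · induction c using Quotient.inductionOn' with
      | h l => exact fun x hx => h3 x (List.mem_toFinset.1 hx)
  · rintro ⟨W, rfl, σ, h1, rfl, h3⟩
    obtain ⟨x, hx, -⟩ := id h1
    have hx' : x ∈ σ.support := mem_support.2 hx
    have hlen : (toList σ x).length = σ.support.card := by
      rw [length_toList, h1.cycleOf_eq hx]
    have hfp : (toList σ x).formPerm = σ := by rw [formPerm_toList, h1.cycleOf_eq hx]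
    refine ⟨toList σ x, ⟨?_, ?_, ?_⟩, hlen⟩
    · exact two_le_length_toList_iff_mem_support.2 hx'
    · exact nodup_toList σ x
    · rw [List.chain_coe_iff_formPerm (nodup_toList σ x), hfp]
      intro y hy
      refine h3 y ?_
      exact mem_support.2 fun h => hx ((mem_toList_iff.1 hy).1.apply_eq_self_iff.2 h)

theorem IsHamiltonian.cyclicOn_univ (h : D.IsHamiltonian) : D.CyclicOn Finset.univ := by
  obtain ⟨c, hc, hall⟩ := h
  obtain ⟨σ, h1, h2, h3⟩ := hc.exists_perm
  refine ⟨σ, h1, ?_, fun x _ => h3 x (hall x)⟩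
  rw [h2, Finset.eq_univ_iff_forall]
  intro x
  have := hall x
  clear h1 h2 h3 hall hc
  induction c using Quotient.inductionOn' with
  | h l => exact List.mem_toFinset.2 this

end

end Digraph

/-! ### Merging cycles of a permutation -/

namespace Equiv.Perm

variable {V : Type*}

/-- If every step of `σ` stays inside a cycle of `τ`, then each cycle of `σ` lies in one of `τ`. -/
theorem SameCycle.mono [Finite V] {σ τ : Perm V} (h : ∀ z, SameCycle τ z (σ z)) {u v : V}
    (huv : SameCycle σ u v) : SameCycle τ u v := by
  obtain ⟨i, rfl⟩ := huv.exists_nat_pow_eq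
  clear huv
  induction i with
  | zero => exact SameCycle.refl _ _
  | succ n ih => rw [pow_succ', mul_apply]; exact ih.trans (h _)

/-- If `τ` agrees with `σ` on the `σ`-cycle of `b` except perhaps at `b` itself, then that whole
`σ`-cycle lies in one cycle of `τ`. -/
theorem SameCycle.of_agree [Finite V] {σ τ : Perm V} {b : V}
    (h : ∀ z, SameCycle σ b z → z ≠ b → τ z = σ z) {u : V} (hu : SameCycle σ b u) :
    SameCycle τ (σ b) u := by
  have h1 : ∀ k : ℕ, SameCycle τ (σ b) ((σ ^ (k + 1)) b) := by
    intro k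
    induction k with
    | zero => exact SameCycle.refl _ _
    | succ n ih =>
      rw [pow_succ', mul_apply]
      by_cases hb : (σ ^ (n + 1)) b = b
      · rw [hb]
      · rw [← h _ (sameCycle_pow_right.2 (SameCycle.refl _ _)) hb]
        exact sameCycle_apply_right.2 ih
  obtain ⟨i, hi, -, rfl⟩ := hu.exists_pow_eq''
  obtain ⟨k, rfl⟩ := Nat.exists_eq_succ_of_ne_zero hi.ne'
  exact h1 k

variable [DecidableEq V]

theorem mul_swap_apply_of_fixed {τ : Perm V} {v x : V} (hv : τ v = v) : (τ * swap v x) x = v := by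
  simp [hv]

theorem sameCycle_mul_swap {τ : Perm V} {v x : V} (hv : τ v = v) (z : V) :
    SameCycle (τ * swap v x) z (τ z) := by
  by_cases hzx : z = x
  · subst hzx
    refine ⟨2, ?_⟩
    rw [zpow_ofNat, pow_two, mul_apply, mul_swap_apply_of_fixed hv]
    simp
  · by_cases hzv : z = v
    · rw [hzv, hv]
    · refine ⟨1, ?_⟩
      simp [swap_apply_of_ne_of_ne hzv hzx]

variable [Fintype V]

/-- Inserting a fixed point `v` into a cycle right after `x`. -/
theorem IsCycle.mul_swap {τ : Perm V} (hτ : τ.IsCycle) {v x : V} (hv : v ∉ τ.support)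
    (hx : x ∈ τ.support) :
    (τ * swap v x).IsCycle ∧ (τ * swap v x).support = insert v τ.support := by
  have hv' : τ v = v := notMem_support.1 hv
  have hx' : τ x ≠ x := mem_support.1 hx
  have hvx : v ≠ x := by rintro rfl; exact hx' hv'
  have hval : ∀ z, z ≠ v → z ≠ x → (τ * swap v x) z = τ z := fun z h1 h2 => by
    simp [swap_apply_of_ne_of_ne h1 h2]
  have hvv : (τ * swap v x) v = τ x := by simp
  have hxv : (τ * swap v x) x = v := by simp [hv']
  constructor
  · refine ⟨x, by rw [hxv]; exact hvx, fun y hy => ?_⟩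
    by_cases hyv : y = v
    · subst hyv
      exact ⟨1, by simpa using hxv⟩
    · refine SameCycle.mono (sameCycle_mul_swap hv') (hτ.sameCycle hx' fun h => hy ?_)
      by_cases hyx : y = x
      · exact absurd (hyx ▸ h) hx'
      · rw [hval y hyv hyx, h]
  · ext y
    rw [mem_support, Finset.mem_insert, mem_support]
    by_cases hyv : y = v
    · subst hyv
      rw [hvv]
      simp only [true_or, iff_true]
      intro h
      exact hvx (τ.injective (hv'.trans h.symm))
    · by_cases hyx : y = x
      · subst hyx
        rw [hxv]; simp [hx', hvx]
      · rw [hval y hyv hyx]; simp [hyv]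

end Equiv.Perm

namespace Digraph

variable {V : Type*} [Fintype V] [DecidableEq V] {D : Digraph V}

/-- `τ` is a directed cycle of `D`, encoded as a cyclic permutation. -/
structure IsCyclePerm (D : Digraph V) (τ : Perm V) : Prop where
  isCycle : τ.IsCycle
  adj : ∀ x ∈ τ.support, D.Adj x (τ x)

theorem IsCyclePerm.cyclicOn {τ : Perm V} (h : D.IsCyclePerm τ) : D.CyclicOn τ.support :=
  ⟨τ, h.isCycle, rfl, h.adj⟩

theorem cyclicOn_iff {W : Finset V} :
    D.CyclicOn W ↔ ∃ τ : Perm V, D.IsCyclePerm τ ∧ τ.support = W :=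
  ⟨fun ⟨τ, h1, h2, h3⟩ => ⟨τ, ⟨h1, h2 ▸ h3⟩, h2⟩, fun ⟨_, h1, h2⟩ => h2 ▸ h1.cyclicOn⟩

theorem IsCyclePerm.exists_insert {τ : Perm V} (h : D.IsCyclePerm τ) {v x : V}
    (hv : v ∉ τ.support) (hx : x ∈ τ.support) (hxv : D.Adj x v) (hvx : D.Adj v (τ x)) :
    ∃ τ' : Perm V, D.IsCyclePerm τ' ∧ τ'.support = insert v τ.support ∧ τ' x = v ∧
      τ' v = τ x ∧ ∀ z, z ≠ x → z ≠ v → τ' z = τ z := by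
  have hv' : τ v = v := notMem_support.1 hv
  obtain ⟨h1, h2⟩ := h.isCycle.mul_swap hv hx
  have e1 : (τ * swap v x) x = v := by simp [hv']
  have e2 : (τ * swap v x) v = τ x := by simp
  have e3 : ∀ z, z ≠ x → z ≠ v → (τ * swap v x) z = τ z := fun z h1 h2 => by
    simp [swap_apply_of_ne_of_ne h2 h1]
  refine ⟨τ * swap v x, ⟨h1, fun z hz => ?_⟩, h2, e1, e2, e3⟩
  by_cases hzx : z = x
  · subst hzx; rwa [e1]
  by_cases hzv : z = v
  · subst hzv; rwa [e2]
  rw [e3 z hzx hzv]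
  rw [h2, Finset.mem_insert] at hz
  exact h.adj z (hz.resolve_left hzv)

theorem IsCyclePerm.exists_insert_two {τ : Perm V} (h : D.IsCyclePerm τ) {u v x : V}
    (hu : u ∉ τ.support) (hv : v ∉ τ.support) (huv : u ≠ v) (hx : x ∈ τ.support)
    (hxu : D.Adj x u) (huv' : D.Adj u v) (hvx : D.Adj v (τ x)) :
    ∃ τ' : Perm V, D.IsCyclePerm τ' ∧ τ'.support = insert v (insert u τ.support) ∧ τ' x = u ∧
      τ' u = v ∧ τ' v = τ x ∧ ∀ z, z ≠ x → z ≠ u → z ≠ v → τ' z = τ z := by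
  -- the intermediate cycle, on which `u` is followed by `τ x`, need not be a cycle of `D`
  have h0 : (⟨fun _ _ => True⟩ : Digraph V).IsCyclePerm τ := ⟨h.isCycle, fun _ _ => trivial⟩
  obtain ⟨τ₁, h1, s1, e1, e1', f1⟩ := h0.exists_insert hu hx trivial trivial
  obtain ⟨τ₂, h2, s2, e2, e2', f2⟩ := h1.exists_insert (v := v) (x := u)
    (by simp only [s1, Finset.mem_insert, not_or]; exact ⟨huv.symm, hv⟩) (by simp [s1])
    trivial trivial
  have hux : u ≠ x := by rintro rfl; exact hu hx
  have hvx' : v ≠ x := by rintro rfl; exact hv hx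
  have e3 : τ₂ x = u := by rw [f2 x hux.symm hvx'.symm, e1]
  have e4 : τ₂ v = τ x := by rw [e2', e1']
  have e5 : ∀ z, z ≠ x → z ≠ u → z ≠ v → τ₂ z = τ z := fun z hzx hzu hzv => by
    rw [f2 z hzu hzv, f1 z hzx hzu]
  refine ⟨τ₂, ⟨h2.isCycle, fun w hw => ?_⟩, by rw [s2, s1], e3, e2, e4, e5⟩
  rw [s2, s1, Finset.mem_insert, Finset.mem_insert] at hw
  by_cases hwx : w = x
  · rwa [hwx, e3]
  by_cases hwu : w = u
  · rwa [hwu, e2]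
  by_cases hwv : w = v
  · rwa [hwv, e4]
  rw [e5 w hwx hwu hwv]
  exact h.adj w (by tauto)

theorem IsCyclePerm.exists_insert_three {τ : Perm V} (h : D.IsCyclePerm τ) {u v w x : V}
    (hu : u ∉ τ.support) (hv : v ∉ τ.support) (hw : w ∉ τ.support) (huv : u ≠ v) (hvw : v ≠ w)
    (huw : u ≠ w) (hx : x ∈ τ.support) (hxu : D.Adj x u) (huv' : D.Adj u v) (hvw' : D.Adj v w)
    (hwx : D.Adj w (τ x)) :
    ∃ τ' : Perm V, D.IsCyclePerm τ' ∧ τ'.support = insert w (insert v (insert u τ.support)) ∧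
      τ' x = u := by
  have h0 : (⟨fun _ _ => True⟩ : Digraph V).IsCyclePerm τ := ⟨h.isCycle, fun _ _ => trivial⟩
  obtain ⟨τ₁, h1, s1, e1, e2, e3, f1⟩ := h0.exists_insert_two hu hv huv hx trivial trivial trivial
  obtain ⟨τ₂, h2, s2, e4, e5, f2⟩ := h1.exists_insert (v := w) (x := v)
    (by simp only [s1, Finset.mem_insert, not_or]; exact ⟨hvw.symm, huw.symm, hw⟩) (by simp [s1])
    trivial trivial
  have hux : u ≠ x := by rintro rfl; exact hu hx
  have hvx' : v ≠ x := by rintro rfl; exact hv hx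
  have hwx' : w ≠ x := by rintro rfl; exact hw hx
  have e6 : τ₂ x = u := by rw [f2 x hvx'.symm hwx'.symm, e1]
  refine ⟨τ₂, ⟨h2.isCycle, fun z hz => ?_⟩, by rw [s2, s1], e6⟩
  rw [s2, s1, Finset.mem_insert, Finset.mem_insert, Finset.mem_insert] at hz
  by_cases hzx : z = x
  · rwa [hzx, e6]
  by_cases hzu : z = u
  · rwa [hzu, f2 u huv huw, e2]
  by_cases hzv : z = v
  · rwa [hzv, e4]
  by_cases hzw : z = w
  · rwa [hzw, e5, e3]
  rw [f2 z hzv hzw, f1 z hzx hzu hzv]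
  exact h.adj z (by tauto)

theorem IsCyclePerm.apply_apply_ne {τ : Perm V} (h : D.IsCyclePerm τ) (h3 : 3 ≤ τ.support.card)
    {x : V} (hx : x ∈ τ.support) : τ (τ x) ≠ x := by
  intro h0
  have hsub : τ.support ⊆ {x, τ x} := by
    intro y hy
    obtain ⟨i, rfl⟩ := (h.isCycle.sameCycle (mem_support.1 hx) (mem_support.1 hy)).exists_nat_pow_eq
    clear hy
    induction i with
    | zero => simp
    | succ n ih =>
      rw [pow_succ', mul_apply]
      rcases Finset.mem_insert.1 ih with h | h
      · rw [h]; simp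
      · rw [Finset.mem_singleton.1 h, h0]; simp
  have := Finset.card_le_card hsub
  have := Finset.card_le_two (a := x) (b := τ x)
  omega

theorem IsCyclePerm.exists_erase {τ : Perm V} (h : D.IsCyclePerm τ) {x : V}
    (hx : τ x ∈ τ.support) (h3 : 3 ≤ τ.support.card) (hadj : D.Adj x (τ (τ x))) :
    ∃ τ' : Perm V, D.IsCyclePerm τ' ∧ τ'.support = τ.support.erase (τ x) ∧ τ' x = τ (τ x) ∧
      ∀ z, z ≠ x → z ≠ τ x → τ' z = τ z := by
  have hx1 : τ (τ x) ≠ τ x := mem_support.1 hx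
  have hx2 : τ x ≠ x := fun h => hx1 (congrArg τ h)
  have hx3 : τ (τ (τ x)) ≠ τ x := h.apply_apply_ne h3 hx
  have hsup := support_swap_mul_eq τ (τ x) hx3
  have e1 : (swap (τ x) (τ (τ x)) * τ) x = τ (τ x) := by simp
  have e2 : ∀ z, z ≠ x → z ≠ τ x → (swap (τ x) (τ (τ x)) * τ) z = τ z := fun z h1 h2 => by
    rw [mul_apply, swap_apply_of_ne_of_ne]
    · exact fun h => h1 (τ.injective h)
    · exact fun h => h2 (τ.injective h)
  rw [Finset.sdiff_singleton_eq_erase] at hsup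
  refine ⟨_, ⟨h.isCycle.swap_mul hx1 hx3, fun z hz => ?_⟩, hsup, e1, e2⟩
  rw [hsup, Finset.mem_erase] at hz
  by_cases hzx : z = x
  · subst hzx; rwa [e1]
  · rw [e2 z hzx hz.1]
    exact h.adj z hz.2

end Digraph

/-! ### Cycles of all lengths in strong semicomplete digraphs -/

/-- If along a cycle of `σ` each vertex satisfies `P` or `Q`, and both occur, then somewhere a
vertex satisfying `P` is followed by one satisfying `Q`. -/
theorem Equiv.Perm.SameCycle.exists_and_apply {V : Type*} [Finite V] {σ : Perm V} {P Q : V → Prop}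
    {x y : V} (hxy : SameCycle σ x y) (hx : P x) (hy : Q y)
    (h : ∀ z, SameCycle σ x z → P z ∨ Q z) :
    ∃ z, SameCycle σ x z ∧ P z ∧ Q (σ z) := by
  by_contra! hcon
  have hall : ∀ i : ℕ, P ((σ ^ i) x) := by
    intro i
    induction i with
    | zero => exact hx
    | succ n ih =>
      rw [pow_succ', mul_apply]
      have h1 : SameCycle σ x ((σ ^ n) x) := sameCycle_pow_right.2 (SameCycle.refl _ _)
      exact (h _ (sameCycle_apply_right.2 h1)).resolve_right (hcon _ h1 ih)
  have h2 : SameCycle σ x (σ.symm y) := sameCycle_symm_apply_right.2 hxy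
  obtain ⟨i, hi⟩ := h2.exists_nat_pow_eq
  have h3 := hcon _ h2 (hi ▸ hall i)
  rw [apply_symm_apply] at h3
  exact h3 hy

namespace Digraph

/-- Every proper nonempty set of vertices is left by some arc. -/
def IsStronglyConnected {V : Type*} (D : Digraph V) : Prop :=
  ∀ S : Set V, S.Nonempty → Sᶜ.Nonempty → ∃ x ∈ S, ∃ y ∉ S, D.Adj x y

variable {V : Type*} [Fintype V] [DecidableEq V] {D : Digraph V}

theorem IsCyclePerm.two_le_card {τ : Perm V} (h : D.IsCyclePerm τ) : 2 ≤ τ.support.card :=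
  h.isCycle.two_le_card_support

/-- Moon's extension step: a non-spanning cycle of a strong semicomplete digraph can be replaced
by a cycle with one more vertex. -/
theorem IsCyclePerm.exists_card_succ (hs : D.IsSemicomplete)
    (hst : D.IsStronglyConnected) {τ : Perm V} (h : D.IsCyclePerm τ)
    (hlt : τ.support.card < Fintype.card V) :
    ∃ τ' : Perm V, D.IsCyclePerm τ' ∧ τ'.support.card = τ.support.card + 1 := by
  by_cases hins : ∃ v ∉ τ.support, (∃ x ∈ τ.support, D.Adj x v) ∧ ∃ x ∈ τ.support, D.Adj v x
  · obtain ⟨v, hv, ⟨x, hx, hxv⟩, y, hy, hvy⟩ := hins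
    obtain ⟨z, hz, hzv, hvz⟩ := (h.isCycle.sameCycle (mem_support.1 hx)
      (mem_support.1 hy)).exists_and_apply (P := fun z => D.Adj z v) (Q := fun z => D.Adj v z)
      hxv hvy fun z hz => by
        refine hs z v ?_
        rintro rfl
        exact hv (mem_support.2 fun h0 => mem_support.1 hx (hz.apply_eq_self_iff.2 h0))
    have hzs : z ∈ τ.support :=
      mem_support.2 fun h0 => mem_support.1 hx (hz.apply_eq_self_iff.2 h0)
    obtain ⟨τ', h1, h2, -⟩ := h.exists_insert hv hzs hzv hvz
    exact ⟨τ', h1, by rw [h2, Finset.card_insert_of_notMem hv]⟩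
  push Not at hins
  have hne : τ.support.Nonempty := Finset.card_pos.1 (by have := h.two_le_card; omega)
  have hcompl : (↑τ.support : Set V)ᶜ.Nonempty := by
    obtain ⟨v, hv⟩ := Finset.exists_mem_notMem_of_card_lt_card
      (s := τ.support) (t := Finset.univ) (by simpa using hlt)
    exact ⟨v, by simpa using hv.2⟩
  obtain ⟨a, ha, y₀, hy₀, hay₀⟩ := hst (↑τ.support) hne hcompl
  have haS : a ∈ τ.support := ha
  -- `O` consists of the outside vertices that the cycle dominates; some arc leaves it
  let O : Set V := {v | v ∉ τ.support ∧ ∃ x ∈ τ.support, D.Adj x v}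
  obtain ⟨y, hyO, z, hz, hyz⟩ := hst O ⟨y₀, hy₀, a, haS, hay₀⟩ ⟨a, fun h => h.1 haS⟩
  have hyS : y ∉ τ.support := hyO.1
  have hzS : z ∉ τ.support := fun hzS => hins y hyO.1 hyO.2 z hzS hyz
  have hznot : ∀ x ∈ τ.support, ¬ D.Adj x z := fun x hx hxz => hz ⟨hzS, x, hx, hxz⟩
  have hzall : ∀ x ∈ τ.support, D.Adj z x := fun x hx =>
    (hs x z (by rintro rfl; exact hzS hx)).resolve_left (hznot x hx)
  have hyall : ∀ x ∈ τ.support, D.Adj x y := fun x hx =>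
    (hs x y (by rintro rfl; exact hyO.1 hx)).resolve_right (hins y hyO.1 hyO.2 x hx)
  -- insert `y → z` after `a`, then skip the old successor of `a`
  have ha1 : τ a ∈ τ.support := apply_mem_support.2 haS
  have ha2 : τ (τ a) ∈ τ.support := apply_mem_support.2 ha1
  have hτ1 : τ a ≠ a := mem_support.1 haS
  have hyτa : τ a ≠ y := by intro h0; rw [h0] at ha1; exact hyS ha1
  have hzτa : τ a ≠ z := by intro h0; rw [h0] at ha1; exact hzS ha1
  have hyz1 : y ≠ z := by rintro rfl; exact hz hyO
  obtain ⟨τ₁, h1, s1, -, -, e1, f1⟩ := h.exists_insert_two hyS hzS hyz1 haS (hyall a haS) hyz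
    (hzall _ ha1)
  have c1 : τ₁.support.card = τ.support.card + 2 := by
    rw [s1, Finset.card_insert_of_notMem (by simp [hyz1.symm, hzS]),
      Finset.card_insert_of_notMem hyS]
  have ha1' : τ a ∈ τ₁.support := by rw [s1]; simp [ha1]
  obtain ⟨τ₂, h2, s2, -⟩ := h1.exists_erase (x := z) (by rwa [e1])
    (by have := h.two_le_card; omega) (by rw [e1, f1 _ hτ1 hyτa hzτa]; exact hzall _ ha2)
  refine ⟨τ₂, h2, ?_⟩
  rw [s2, e1, Finset.card_erase_of_mem ha1', c1]
  omega

theorem isCyclePerm_swap {x y : V} (hne : x ≠ y) (hxy : D.Adj x y) (hyx : D.Adj y x) :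
    D.IsCyclePerm (swap x y) := by
  refine ⟨isCycle_swap hne, fun z hz => ?_⟩
  rw [support_swap hne, Finset.mem_insert, Finset.mem_singleton] at hz
  rcases hz with rfl | rfl
  · simpa using hxy
  · simpa using hyx

/-- A directed triangle, with its successor function. -/
theorem exists_isCyclePerm_triangle {x y z : V} (hxy : x ≠ y) (hyz : y ≠ z) (hxz : x ≠ z)
    (h1 : D.Adj x y) (h2 : D.Adj y z) (h3 : D.Adj z x) :
    ∃ τ : Perm V, D.IsCyclePerm τ ∧ τ.support = {x, y, z} ∧ τ x = y ∧ τ y = z ∧ τ z = x := by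
  have h0 : (⟨fun _ _ => True⟩ : Digraph V).IsCyclePerm (swap x y) :=
    isCyclePerm_swap hxy trivial trivial
  obtain ⟨τ, h, s, e, e', f⟩ := h0.exists_insert (v := z) (x := y)
    (by simp [support_swap hxy, hyz.symm, hxz.symm]) (by simp [support_swap hxy]) trivial trivial
  rw [swap_apply_right] at e'
  have e'' : τ x = y := by rw [f x hxy hxz, swap_apply_left]
  have s' : τ.support = {x, y, z} := by
    rw [s, support_swap hxy]
    ext w; simp only [Finset.mem_insert, Finset.mem_singleton]; tauto
  refine ⟨τ, ⟨h.isCycle, fun w hw => ?_⟩, s', e'', e, e'⟩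
  rw [s'] at hw
  simp only [Finset.mem_insert, Finset.mem_singleton] at hw
  rcases hw with rfl | rfl | rfl
  · rwa [e'']
  · rwa [e]
  · rwa [e']

/-- Moon's theorem: a strong semicomplete digraph with at least three vertices is pancyclic. -/
theorem IsStronglyConnected.exists_cyclicOn (hl : D.IsLoopless) (hs : D.IsSemicomplete)
    (hst : D.IsStronglyConnected) {k : ℕ} (hk : 3 ≤ k) (hkn : k ≤ Fintype.card V) :
    ∃ W : Finset V, W.card = k ∧ D.CyclicOn W := by
  have hstart : ∃ τ : Perm V, D.IsCyclePerm τ ∧ τ.support.card ≤ 3 := by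
    by_cases hdig : ∃ x y, D.Adj x y ∧ D.Adj y x
    · obtain ⟨x, y, h1, h2⟩ := hdig
      have hne : x ≠ y := by rintro rfl; exact hl x h1
      exact ⟨swap x y, isCyclePerm_swap hne h1 h2, by rw [card_support_swap hne]; omega⟩
    · push Not at hdig
      have : Nontrivial V := Fintype.one_lt_card_iff_nontrivial.1 (by omega)
      obtain ⟨v, w, hvw⟩ := exists_pair_ne V
      obtain ⟨v', hv', y, hy, hvy⟩ := hst {v} ⟨v, rfl⟩ ⟨w, hvw.symm⟩
      rw [Set.mem_singleton_iff.1 hv'] at hvy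
      obtain ⟨y, hvy, z, hz, hyz⟩ := hst {y | D.Adj v y} ⟨y, hvy⟩ ⟨v, hl v⟩
      have hzv : z ≠ v := by rintro rfl; exact hdig _ _ hvy hyz
      have hvy' : v ≠ y := by rintro rfl; exact hl _ hvy
      have hyz' : y ≠ z := by rintro rfl; exact hl _ hyz
      obtain ⟨τ, h, s, -⟩ := exists_isCyclePerm_triangle hvy' hyz' hzv.symm hvy hyz
        ((hs z v hzv).resolve_right hz)
      exact ⟨τ, h, by rw [s]; exact Finset.card_le_three⟩
  obtain ⟨τ₀, h0, hc0⟩ := hstart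
  have hgrow : ∀ m, τ₀.support.card ≤ m → m ≤ Fintype.card V →
      ∃ τ : Perm V, D.IsCyclePerm τ ∧ τ.support.card = m := by
    intro m hm
    induction m, hm using Nat.le_induction with
    | base => exact fun _ => ⟨τ₀, h0, rfl⟩
    | succ m hm ih =>
      intro hle
      obtain ⟨τ, h, rfl⟩ := ih (by omega)
      exact h.exists_card_succ hs hst (by omega)
  obtain ⟨τ, h, hc⟩ := hgrow k (by omega) hkn
  exact ⟨_, hc, h.cyclicOn⟩

end Digraph

/-! ### Merging the cycles of a cycle factor -/

namespace Equiv.Perm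

variable {V : Type*}

theorem not_sameCycle_of_closed [Finite V] {σ : Perm V} {S : Set V} (hS : ∀ x ∈ S, σ x ∈ S)
    {x y : V} (hx : x ∈ S) (hy : y ∉ S) : ¬ SameCycle σ x y := by
  intro h
  obtain ⟨i, rfl⟩ := h.exists_nat_pow_eq
  apply hy
  clear h hy
  induction i with
  | zero => exact hx
  | succ n ih => rw [pow_succ', mul_apply]; exact hS _ ih

theorem eq_of_pow_apply_eq {σ : Perm V} {x : V} {i j : ℕ} (hi : i < Function.minimalPeriod σ x)
    (hj : j < Function.minimalPeriod σ x) (h : (σ ^ i) x = (σ ^ j) x) : i = j := by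
  apply Function.iterate_injOn_Iio_minimalPeriod (f := σ) (x := x) hi hj
  simpa only [iterate_eq_pow] using h

variable [Fintype V]

open Classical in
/-- The vertices on the cycle of `σ` through `x`. -/
noncomputable def cycleFinset (σ : Perm V) (x : V) : Finset V :=
  Finset.univ.filter fun y => SameCycle σ x y

theorem mem_cycleFinset {σ : Perm V} {x y : V} : y ∈ cycleFinset σ x ↔ SameCycle σ x y := by
  simp [cycleFinset]

theorem minimalPeriod_pos (σ : Perm V) (x : V) : 0 < Function.minimalPeriod σ x := by
  obtain ⟨i, hi, -, h⟩ := (SameCycle.refl σ x).exists_pow_eq''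
  exact Function.minimalPeriod_pos_of_mem_periodicPts
    (Function.mk_mem_periodicPts hi (by rw [Function.IsPeriodicPt, iterate_eq_pow]; exact h))

theorem SameCycle.exists_lt_minimalPeriod {σ : Perm V} {x y : V} (h : SameCycle σ x y) :
    ∃ i < Function.minimalPeriod σ x, (σ ^ i) x = y := by
  obtain ⟨i, rfl⟩ := h.exists_nat_pow_eq
  refine ⟨i % Function.minimalPeriod σ x, Nat.mod_lt _ (minimalPeriod_pos σ x), ?_⟩
  rw [← iterate_eq_pow, ← iterate_eq_pow, Function.iterate_mod_minimalPeriod_eq]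

theorem card_cycleFinset (σ : Perm V) (x : V) :
    (cycleFinset σ x).card = Function.minimalPeriod σ x := by
  classical
  have : cycleFinset σ x = (Finset.range (Function.minimalPeriod σ x)).image
      fun i => (σ ^ i) x := by
    ext y
    rw [mem_cycleFinset, Finset.mem_image]
    constructor
    · intro h
      obtain ⟨i, hi, rfl⟩ := h.exists_lt_minimalPeriod
      exact ⟨i, Finset.mem_range.2 hi, rfl⟩
    · rintro ⟨i, -, rfl⟩
      exact sameCycle_pow_right.2 (SameCycle.refl _ _)
  rw [this, Finset.card_image_of_injOn, Finset.card_range]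
  intro i hi j hj h
  exact eq_of_pow_apply_eq (by simpa using hi) (by simpa using hj) h

theorem card_cycleFinset_lt {σ τ : Perm V} {x w : V}
    (h : ∀ z, SameCycle σ x z → SameCycle τ x z) (hw : SameCycle τ x w) (hw' : ¬ SameCycle σ x w) :
    (cycleFinset σ x).card < (cycleFinset τ x).card := by
  apply Finset.card_lt_card
  rw [Finset.ssubset_iff_of_subset fun z hz => mem_cycleFinset.2 (h z (mem_cycleFinset.1 hz))]
  exact ⟨w, mem_cycleFinset.2 hw, fun h => hw' (mem_cycleFinset.1 h)⟩

end Equiv.Perm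

namespace Digraph

variable {V ι : Type*} {T : Digraph ι} {c : V → ι}
  {U : Finset V}

/-- `σ` is a cycle factor on `U` of the blow-up of `T` along `c`: it permutes `U`, fixes everything
else, and `x ↦ σ x` covers an arc of `T` for `x ∈ U`. -/
structure IsFactor (T : Digraph ι) (c : V → ι) (U : Finset V) (σ : Perm V) : Prop where
  adj : ∀ x ∈ U, T.Adj (c x) (c (σ x))
  fixed : ∀ x ∉ U, σ x = x

theorem IsFactor.apply_mem {σ : Perm V} (h : IsFactor T c U σ) {x : V} (hx : x ∈ U) : σ x ∈ U := by
  by_contra h0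
  have := σ.injective (h.fixed _ h0)
  exact h0 (by rwa [this])

variable [Fintype V]

theorem IsFactor.mem_of_sameCycle {σ : Perm V} (h : IsFactor T c U σ) {x y : V} (hx : x ∈ U)
    (hxy : SameCycle σ x y) : y ∈ U := by
  by_contra hy
  exact not_sameCycle_of_closed (S := (U : Set V)) (fun _ => h.apply_mem) hx hy hxy

variable [DecidableEq V]

/-- Two cycles of a factor merge if `a → σ b` and `b → σ a` for some `a`, `b` on them. -/
theorem IsFactor.merge_two {σ : Perm V} (h : IsFactor T c U σ) {a b : V} (ha : a ∈ U) (hb : b ∈ U)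
    (hab : ¬ SameCycle σ a b) (h1 : T.Adj (c a) (c (σ b))) (h2 : T.Adj (c b) (c (σ a))) :
    ∃ τ, IsFactor T c U τ ∧ (∀ z, SameCycle σ a z → SameCycle τ a z) ∧ SameCycle τ a b := by
  have hne : a ≠ b := by rintro rfl; exact hab (SameCycle.refl _ _)
  have ea : (σ * swap a b) a = σ b := by simp
  have eb : (σ * swap a b) b = σ a := by simp
  have eo : ∀ z, z ≠ a → z ≠ b → (σ * swap a b) z = σ z := fun z h1 h2 => by
    simp [swap_apply_of_ne_of_ne h1 h2]
  refine ⟨σ * swap a b, ⟨fun x hx => ?_, fun x hx => ?_⟩, ?_⟩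
  · by_cases hxa : x = a
    · rw [hxa, ea]; exact h1
    by_cases hxb : x = b
    · rw [hxb, eb]; exact h2
    rw [eo x hxa hxb]; exact h.adj x hx
  · rw [eo x (by rintro rfl; exact hx ha) (by rintro rfl; exact hx hb), h.fixed x hx]
  · have hA : ∀ u, SameCycle σ a u → SameCycle (σ * swap a b) (σ a) u := fun u =>
      SameCycle.of_agree fun z hz hza => eo z hza (by rintro rfl; exact hab hz)
    have hB : ∀ u, SameCycle σ b u → SameCycle (σ * swap a b) (σ b) u := fun u =>
      SameCycle.of_agree fun z hz hzb => eo z (by rintro rfl; exact hab hz.symm) hzb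
    have hAa := hA a (SameCycle.refl _ _)
    refine ⟨fun z hz => hAa.symm.trans (hA z hz), ?_⟩
    refine SameCycle.trans ?_ (hB b (SameCycle.refl _ _))
    rw [← ea]; exact sameCycle_apply_right.2 (SameCycle.refl _ _)

/-- Three cycles of a factor merge along `a → σ b`, `b → σ d`, `d → σ a`. -/
theorem IsFactor.merge_three {σ : Perm V} (h : IsFactor T c U σ) {a b d : V} (ha : a ∈ U)
    (hb : b ∈ U) (hd : d ∈ U) (hab : ¬ SameCycle σ a b) (had : ¬ SameCycle σ a d)
    (hbd : ¬ SameCycle σ b d) (h1 : T.Adj (c a) (c (σ b))) (h2 : T.Adj (c b) (c (σ d)))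
    (h3 : T.Adj (c d) (c (σ a))) :
    ∃ τ, IsFactor T c U τ ∧ (∀ z, SameCycle σ a z → SameCycle τ a z) ∧ SameCycle τ a b := by
  have hne : a ≠ b := by rintro rfl; exact hab (SameCycle.refl _ _)
  have hne2 : a ≠ d := by rintro rfl; exact had (SameCycle.refl _ _)
  have hne3 : b ≠ d := by rintro rfl; exact hbd (SameCycle.refl _ _)
  set τ := σ * (swap a b * swap b d) with hτ
  have ea : τ a = σ b := by simp [hτ, swap_apply_of_ne_of_ne hne hne2]
  have eb : τ b = σ d := by simp [hτ, swap_apply_of_ne_of_ne hne2.symm hne3.symm]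
  have ed : τ d = σ a := by simp [hτ]
  have eo : ∀ z, z ≠ a → z ≠ b → z ≠ d → τ z = σ z := fun z h1 h2 h3 => by
    simp [hτ, swap_apply_of_ne_of_ne h1 h2, swap_apply_of_ne_of_ne h2 h3]
  refine ⟨τ, ⟨fun x hx => ?_, fun x hx => ?_⟩, ?_⟩
  · by_cases hxa : x = a
    · rw [hxa, ea]; exact h1
    by_cases hxb : x = b
    · rw [hxb, eb]; exact h2
    by_cases hxd : x = d
    · rw [hxd, ed]; exact h3
    rw [eo x hxa hxb hxd]; exact h.adj x hx
  · rw [eo x (by rintro rfl; exact hx ha) (by rintro rfl; exact hx hb)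
      (by rintro rfl; exact hx hd), h.fixed x hx]
  · have hA : ∀ u, SameCycle σ a u → SameCycle τ (σ a) u := fun u =>
      SameCycle.of_agree fun z hz hza =>
        eo z hza (by rintro rfl; exact hab hz) (by rintro rfl; exact had hz)
    have hB : ∀ u, SameCycle σ b u → SameCycle τ (σ b) u := fun u =>
      SameCycle.of_agree fun z hz hzb =>
        eo z (by rintro rfl; exact hab hz.symm) hzb (by rintro rfl; exact hbd hz)
    have hAa := hA a (SameCycle.refl _ _)
    refine ⟨fun z hz => hAa.symm.trans (hA z hz), ?_⟩
    refine SameCycle.trans ?_ (hB b (SameCycle.refl _ _))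
    rw [← ea]; exact sameCycle_apply_right.2 (SameCycle.refl _ _)

/-- If `σ⁻ⁱ x → σⁱ y → σ¹⁻ⁱ x` for all `i`, and the cycle of `y` is at most as long as that of `x`,
then each `σⁱ y` can be inserted into the cycle of `x`, between `σ⁻ⁱ x` and `σ¹⁻ⁱ x`. -/
theorem IsFactor.interleave {σ : Perm V} (h : IsFactor T c U σ) {x y : V} (hx : x ∈ U)
    (hy : y ∈ U) (hxy : ¬ SameCycle σ x y)
    (hle : Function.minimalPeriod σ y ≤ Function.minimalPeriod σ x)
    (h1 : ∀ i : ℕ, T.Adj (c ((σ ^ i)⁻¹ x)) (c ((σ ^ i) y)))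
    (h2 : ∀ i : ℕ, T.Adj (c ((σ ^ i) y)) (c (σ ((σ ^ i)⁻¹ x)))) :
    ∃ τ, IsFactor T c U τ ∧ (∀ z, SameCycle σ x z → SameCycle τ x z) ∧ SameCycle τ x y := by
  have app_inv : ∀ (f : Perm V) (z : V), f (f⁻¹ z) = z := fun f z => by
    rw [← mul_apply, mul_inv_cancel, one_apply]
  have hxs : ∀ i : ℕ, SameCycle σ x ((σ ^ i)⁻¹ x) := fun i => by
    have : SameCycle σ x ((σ ^ (-(i : ℤ))) x) := sameCycle_zpow_right.2 (SameCycle.refl _ _)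
    simpa using this
  have hys : ∀ i : ℕ, SameCycle σ y ((σ ^ i) y) := fun i =>
    sameCycle_pow_right.2 (SameCycle.refl _ _)
  have hxinj : ∀ i j : ℕ, i < Function.minimalPeriod σ x → j < Function.minimalPeriod σ x →
      (σ ^ i)⁻¹ x = (σ ^ j)⁻¹ x → i = j := by
    intro i j hi hj hij
    refine (eq_of_pow_apply_eq (σ := σ) (x := x) hj hi ?_).symm
    have e1 := congrArg (σ ^ i * σ ^ j) hij
    simp only [mul_apply, app_inv] at e1
    rw [← mul_apply, ← pow_add, add_comm, pow_add, mul_apply, app_inv] at e1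
    exact e1
  have key : ∀ k ≤ Function.minimalPeriod σ y, ∃ τ : Perm V,
      (∀ z, ¬ SameCycle σ y z → (∀ i < k, z ≠ (σ ^ i)⁻¹ x) → τ z = σ z) ∧
      (∀ i, k ≤ i → i < Function.minimalPeriod σ y → τ ((σ ^ i) y) = (σ ^ i) y) ∧
      (∀ z ∈ U, (¬ SameCycle σ y z ∨ ∃ i < k, z = (σ ^ i) y) → T.Adj (c z) (c (τ z))) ∧
      (∀ z, SameCycle σ x z → SameCycle τ x z) ∧
      (∀ i < k, SameCycle τ x ((σ ^ i) y)) := by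
    intro k
    induction k with
    | zero =>
      intro _
      have e1 : ∀ z, SameCycle σ y z → (σ * (σ.cycleOf y)⁻¹) z = z := fun z hz => by
        rw [mul_apply, cycleOf_inv, (sameCycle_inv.2 hz).cycleOf_apply, app_inv]
      have e2 : ∀ z, ¬ SameCycle σ y z → (σ * (σ.cycleOf y)⁻¹) z = σ z := fun z hz => by
        rw [mul_apply, cycleOf_inv,
          cycleOf_apply_of_not_sameCycle (fun h => hz (sameCycle_inv.1 h))]
      refine ⟨σ * (σ.cycleOf y)⁻¹, fun z hz _ => e2 z hz, fun i _ _ => e1 _ (hys i), ?_, ?_, ?_⟩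
      · rintro z hz (hz' | ⟨i, hi, -⟩)
        · rw [e2 z hz']; exact h.adj z hz
        · omega
      · intro z hz
        have := SameCycle.of_agree (τ := σ * (σ.cycleOf y)⁻¹) (b := x)
          (fun w hw _ => e2 w fun hyw => hxy (hw.trans hyw.symm)) hz
        rw [← e2 x fun h => hxy h.symm] at this
        exact sameCycle_apply_left.1 this
      · intro i hi; omega
    | succ k ih =>
      intro hk
      obtain ⟨τ, ha, hb, hc, hd, he⟩ := ih (by omega)
      have hvfix := hb k le_rfl (by omega)
      have hxnot : ¬ SameCycle σ y ((σ ^ k)⁻¹ x) := fun h => hxy ((hxs k).trans h.symm)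
      have hxne : ∀ i < k, (σ ^ k)⁻¹ x ≠ (σ ^ i)⁻¹ x := fun i hi h => by
        have := hxinj k i (by omega) (by omega) h
        omega
      have hne : ∀ z, ¬ SameCycle σ y z → z ≠ (σ ^ k) y := fun z hz h => hz (h ▸ hys k)
      have e1 : (τ * swap ((σ ^ k) y) ((σ ^ k)⁻¹ x)) ((σ ^ k)⁻¹ x) = (σ ^ k) y :=
        mul_swap_apply_of_fixed hvfix
      have e2 : (τ * swap ((σ ^ k) y) ((σ ^ k)⁻¹ x)) ((σ ^ k) y) = σ ((σ ^ k)⁻¹ x) := by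
        rw [mul_apply, swap_apply_left, ha _ hxnot hxne]
      have e3 : ∀ z, z ≠ (σ ^ k) y → z ≠ (σ ^ k)⁻¹ x →
          (τ * swap ((σ ^ k) y) ((σ ^ k)⁻¹ x)) z = τ z := fun z h1 h2 => by
        rw [mul_apply, swap_apply_of_ne_of_ne h1 h2]
      have hmono : ∀ z, SameCycle τ x z →
          SameCycle (τ * swap ((σ ^ k) y) ((σ ^ k)⁻¹ x)) x z := fun z hz =>
        SameCycle.mono (sameCycle_mul_swap hvfix) hz
      refine ⟨_, ?_, ?_, ?_, fun z hz => hmono z (hd z hz), ?_⟩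
      · intro z hz hz'
        rw [e3 z (hne z hz) (hz' k (by omega))]
        exact ha z hz fun i hi => hz' i (by omega)
      · intro i hi hi'
        rw [e3 _ (fun h => ?_) (fun h => hxnot (h ▸ hys i)), hb i (by omega) hi']
        have := eq_of_pow_apply_eq hi' (by omega : k < _) h
        omega
      · intro z hz hz'
        by_cases hzv : z = (σ ^ k) y
        · rw [hzv, e2]; exact h2 k
        by_cases hzx : z = (σ ^ k)⁻¹ x
        · rw [hzx, e1]; exact h1 k
        rw [e3 z hzv hzx]
        refine hc z hz (hz'.imp_right ?_)
        rintro ⟨i, hi, rfl⟩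
        refine ⟨i, ?_, rfl⟩
        rcases Nat.lt_succ_iff_lt_or_eq.1 hi with h | rfl
        exacts [h, absurd rfl hzv]
      · intro i hi
        rcases Nat.lt_succ_iff_lt_or_eq.1 hi with h | rfl
        · exact hmono _ (he i h)
        · refine (hmono _ (hd _ (hxs i))).trans ?_
          nth_rewrite 2 [← e1]
          exact sameCycle_apply_right.2 (SameCycle.refl _ _)
  obtain ⟨τ, ha, hb, hc, hd, he⟩ := key _ le_rfl
  refine ⟨τ, ⟨fun z hz => hc z hz ?_, fun z hz => ?_⟩, hd,
    by simpa using he 0 (minimalPeriod_pos σ y)⟩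
  · by_cases hyz : SameCycle σ y z
    · obtain ⟨i, hi, rfl⟩ := hyz.exists_lt_minimalPeriod
      exact Or.inr ⟨i, hi, rfl⟩
    · exact Or.inl hyz
  · rw [ha z (fun h0 => hz (h.mem_of_sameCycle hy h0)) fun i _ h0 =>
      hz (h0 ▸ h.mem_of_sameCycle hx (hxs i)), h.fixed z hz]

/-- A cycle factor of a blow-up of a strong semicomplete digraph, in which every vertex of the
digraph is blown up to a nonempty class, can be replaced by a single cycle on the same vertices. -/
theorem IsFactor.exists_isCycle {σ₀ : Perm V} (h₀ : IsFactor T c U σ₀) (hl : T.IsLoopless)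
    (hs : T.IsSemicomplete) (hst : T.IsStronglyConnected) (hU : U.Nonempty)
    (hhit : ∀ i, ∃ x ∈ U, c x = i) :
    ∃ σ : Perm V, σ.IsCycle ∧ σ.support = U ∧ ∀ x ∈ U, T.Adj (c x) (c (σ x)) := by
  classical
  -- choose a factor `σ` and a vertex `x` on a cycle of the largest possible length
  have hne : (Finset.univ.filter fun p : Perm V × V => IsFactor T c U p.1 ∧ p.2 ∈ U).Nonempty := by
    obtain ⟨x, hx⟩ := hU
    exact ⟨(σ₀, x), by simp [h₀, hx]⟩
  obtain ⟨⟨σ, x⟩, hmem, hmax⟩ := Finset.exists_max_image _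
    (fun p : Perm V × V => (cycleFinset p.1 p.2).card) hne
  simp only [Finset.mem_filter, Finset.mem_univ, true_and, Prod.forall, and_imp] at hmem hmax
  obtain ⟨h, hx⟩ := hmem
  have hno : ∀ τ, IsFactor T c U τ → ∀ a w, SameCycle σ x a →
      (∀ z, SameCycle σ a z → SameCycle τ a z) → SameCycle τ a w → SameCycle σ a w := by
    intro τ hτ a w hxa hz hw
    by_contra hw'
    have h1 := card_cycleFinset_lt hz hw hw'
    have h2 : cycleFinset σ a = cycleFinset σ x := by
      ext z
      rw [mem_cycleFinset, mem_cycleFinset]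
      exact ⟨hxa.trans, hxa.symm.trans⟩
    have h3 := hmax τ a hτ (h.mem_of_sameCycle hx hxa)
    rw [h2] at h1
    omega
  have hns : ∀ a ∈ U, ∀ b ∈ U, SameCycle σ x a → ¬ SameCycle σ x b →
      ¬ (T.Adj (c a) (c (σ b)) ∧ T.Adj (c b) (c (σ a))) := by
    rintro a ha b hb hxa hxb ⟨h1, h2⟩
    have hab : ¬ SameCycle σ a b := fun hab => hxb (hxa.trans hab)
    obtain ⟨τ, hτ, hz, hw⟩ := h.merge_two ha hb hab h1 h2
    exact hab (hno τ hτ a b hxa hz hw)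
  by_cases hall : ∀ y ∈ U, SameCycle σ x y
  · have hsup : σ.support = U := by
      ext z
      rw [mem_support]
      refine ⟨fun hz => by_contra fun hzU => hz (h.fixed z hzU), fun hz h0 => ?_⟩
      have := h.adj z hz
      rw [h0] at this
      exact hl _ this
    exact ⟨σ, ⟨x, mem_support.1 (hsup ▸ hx), fun y hy => hall y (hsup ▸ mem_support.2 hy)⟩, hsup,
      h.adj⟩
  exfalso
  push Not at hall
  obtain ⟨y₁, hy₁, hxy₁⟩ := hall
  have hO : ∀ a, SameCycle σ x a → a ∈ U := fun a => h.mem_of_sameCycle hx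
  have hclass : ∀ a b, SameCycle σ x a → b ∈ U → ¬ SameCycle σ x b → c a ≠ c b := by
    intro a b ha hb hxb hab
    exact hns a (hO a ha) b hb ha hxb ⟨hab ▸ h.adj b hb, hab ▸ h.adj a (hO a ha)⟩
  have hrule1 : ∀ a b, SameCycle σ x a → b ∈ U → ¬ SameCycle σ x b → T.Adj (c a) (c (σ b)) →
      T.Adj (c (σ a)) (c b) := by
    intro a b ha hb hxb h1
    refine (hs _ _ ?_).resolve_right fun h2 => hns a (hO a ha) b hb ha hxb ⟨h1, h2⟩
    exact hclass _ _ (sameCycle_apply_right.2 ha) hb hxb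
  have hrule2 : ∀ a b, SameCycle σ x a → b ∈ U → ¬ SameCycle σ x b → T.Adj (c b) (c (σ a)) →
      T.Adj (c (σ b)) (c a) := by
    intro a b ha hb hxb h1
    refine (hs _ _ ?_).resolve_right fun h2 => hns a (hO a ha) b hb ha hxb ⟨h2, h1⟩
    exact (hclass _ _ ha (h.apply_mem hb) fun h => hxb (sameCycle_apply_right.1 h)).symm
  have hout : ∀ b b', b ∈ U → ¬ SameCycle σ x b → SameCycle σ b b' → b' ∈ U ∧ ¬ SameCycle σ x b' :=
    fun b b' hb hxb hbb => ⟨h.mem_of_sameCycle hb hbb, fun h0 => hxb (h0.trans hbb.symm)⟩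
  have hinv : ∀ (k : ℕ) z, σ ((σ ^ (k + 1))⁻¹ z) = (σ ^ k)⁻¹ z := by
    intro k z
    rw [pow_succ, mul_inv_rev, ← mul_apply, ← mul_assoc, mul_inv_cancel, one_mul]
  have hinvs : ∀ (k : ℕ) z, SameCycle σ z ((σ ^ k)⁻¹ z) := fun k z => by
    have : SameCycle σ z ((σ ^ (-(k : ℤ))) z) := sameCycle_zpow_right.2 (SameCycle.refl _ _)
    simpa using this
  have hiter1 : ∀ (k : ℕ) a b, SameCycle σ x a → b ∈ U → ¬ SameCycle σ x b →
      T.Adj (c a) (c b) → T.Adj (c ((σ ^ k) a)) (c ((σ ^ k)⁻¹ b)) := by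
    intro k a b ha hb hxb h1
    induction k with
    | zero => simpa using h1
    | succ k ih =>
      obtain ⟨h2, h3⟩ := hout b _ hb hxb (hinvs (k + 1) b)
      rw [pow_succ' σ k, mul_apply, ← pow_succ']
      exact hrule1 _ _ (sameCycle_pow_right.2 ha) h2 h3 (by rwa [hinv])
  have hiter2 : ∀ (k : ℕ) a b, SameCycle σ x a → b ∈ U → ¬ SameCycle σ x b →
      T.Adj (c b) (c a) → T.Adj (c ((σ ^ k) b)) (c ((σ ^ k)⁻¹ a)) := by
    intro k a b ha hb hxb h1
    induction k with
    | zero => simpa using h1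
    | succ k ih =>
      obtain ⟨h2, h3⟩ := hout b _ hb hxb ((sameCycle_pow_right (n := k)).2 (SameCycle.refl σ b))
      rw [pow_succ' σ k, mul_apply, ← pow_succ']
      exact hrule2 _ _ (ha.trans (hinvs _ _)) h2 h3 (by rwa [hinv])
  -- a vertex `y` on another cycle is dominated by all of the cycle of `x`, or dominates all of it
  have hdich : ∀ y ∈ U, ¬ SameCycle σ x y → ∀ a b, SameCycle σ x a → SameCycle σ x b →
      T.Adj (c a) (c y) → ¬ T.Adj (c y) (c b) := by
    intro y hy hxy a b ha hb h1 h2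
    obtain ⟨z, hz, hzy, hyz⟩ := (ha.symm.trans hb).exists_and_apply
      (P := fun z => T.Adj (c z) (c y)) (Q := fun z => T.Adj (c y) (c z)) h1 h2
      fun z hz => hs _ _ (hclass z y (ha.trans hz) hy hxy)
    replace hz : SameCycle σ x z := ha.trans hz
    have hyO : ¬ SameCycle σ z y := fun h => hxy (hz.trans h)
    have hcard : Function.minimalPeriod σ y ≤ Function.minimalPeriod σ z := by
      rw [← card_cycleFinset, ← card_cycleFinset]
      have h2 : cycleFinset σ z = cycleFinset σ x := by
        ext w
        rw [mem_cycleFinset, mem_cycleFinset]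
        exact ⟨hz.trans, hz.symm.trans⟩
      rw [h2]
      exact hmax σ y h hy
    obtain ⟨τ, hτ, h3, h4⟩ := h.interleave (hO z hz) hy hyO hcard (fun i => by
        obtain ⟨k, hk⟩ := mem_powers_iff_mem_zpowers.2
          (inv_mem (pow_mem (Subgroup.mem_zpowers σ) i))
        have := hiter1 k z y hz hy hxy hzy
        simp only at hk
        rwa [hk, inv_inv] at this) (fun i => by
        have := hiter2 i (σ z) y (sameCycle_apply_right.2 hz) hy hxy hyz
        rwa [← mul_apply, ((Commute.refl σ).pow_left i).inv_left.eq, mul_apply] at this)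
    exact hyO (hno τ hτ z y hz h3 h4)
  -- `O` consists of the vertices on other cycles that the cycle of `x` dominates
  let O : Set V := {y | y ∈ U ∧ ¬ SameCycle σ x y ∧ ∃ a, SameCycle σ x a ∧ T.Adj (c a) (c y)}
  have hOall : ∀ y ∈ O, ∀ a, SameCycle σ x a → T.Adj (c a) (c y) := by
    rintro y ⟨hy, hxy, b, hb, hby⟩ a ha
    exact (hs _ _ (hclass a y ha hy hxy)).resolve_right (hdich y hy hxy b a hb ha hby)
  have hIall : ∀ y ∈ U, ¬ SameCycle σ x y → y ∉ O → ∀ a, SameCycle σ x a → T.Adj (c y) (c a) :=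
    fun y hy hxy hyO a ha => (hs _ _ (hclass a y ha hy hxy)).resolve_left
      fun h1 => hyO ⟨hy, hxy, a, ha, h1⟩
  have hOclosed : ∀ y ∈ O, σ y ∈ O := by
    intro y hyO
    by_contra h1
    have h2 := hout y (σ y) hyO.1 hyO.2.1 (sameCycle_apply_right.2 (SameCycle.refl _ _))
    have h3 := hIall _ h2.1 h2.2 h1 x (SameCycle.refl _ _)
    have h5 := hOall y hyO x (SameCycle.refl _ _)
    obtain ⟨k, hk⟩ := mem_powers_iff_mem_zpowers.2 (inv_mem (Subgroup.mem_zpowers σ))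
    simp only at hk
    have h4 := hiter1 k x y (SameCycle.refl _ _) hyO.1 hyO.2.1 h5
    rw [hk, inv_inv] at h4
    exact hdich _ h2.1 h2.2 _ _ (hk ▸ sameCycle_pow_right.2 (SameCycle.refl _ _))
      (SameCycle.refl _ _) h4 h3
  obtain ⟨_, ⟨a₀, ha₀, rfl⟩, j₀, hj₀, hadj₀⟩ := hst (c '' {a | SameCycle σ x a})
    ⟨_, x, SameCycle.refl _ _, rfl⟩ ⟨c y₁, by
      rintro ⟨a, ha, hay⟩
      exact hclass a y₁ ha hy₁ hxy₁ hay⟩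
  obtain ⟨y₀, hy₀, rfl⟩ := hhit j₀
  have hy₀O : y₀ ∈ O := ⟨hy₀, fun h0 => hj₀ ⟨y₀, h0, rfl⟩, a₀, ha₀, hadj₀⟩
  obtain ⟨_, ⟨y, hyO, rfl⟩, j, hj, hadj⟩ := hst (c '' O) ⟨_, y₀, hy₀O, rfl⟩ ⟨c x, by
    rintro ⟨y, hyO, hyx⟩
    exact hclass x y (SameCycle.refl _ _) hyO.1 hyO.2.1 hyx.symm⟩
  obtain ⟨z, hz, rfl⟩ := hhit j
  have hzO : z ∉ O := fun h0 => hj ⟨z, h0, rfl⟩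
  have hxz : ¬ SameCycle σ x z := fun h0 =>
    hdich y hyO.1 hyO.2.1 x z (SameCycle.refl _ _) h0 (hOall y hyO x (SameCycle.refl _ _)) hadj
  have hzz : SameCycle σ z (σ.symm z) := sameCycle_symm_apply_right.2 (SameCycle.refl _ _)
  have hz' := hout z (σ.symm z) hz hxz hzz
  have hz'O : σ.symm z ∉ O := fun h0 => hzO (by simpa using hOclosed _ h0)
  have hyz : ¬ SameCycle σ y (σ.symm z) := not_sameCycle_of_closed hOclosed hyO hz'O
  obtain ⟨τ, hτ, h3, h4⟩ := h.merge_three hx hyO.1 hz'.1 hyO.2.1 hz'.2 hyz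
    (hOall _ (hOclosed y hyO) x (SameCycle.refl _ _)) (by rwa [apply_symm_apply])
    (hIall _ hz'.1 hz'.2 hz'O _ (sameCycle_apply_right.2 (SameCycle.refl _ _)))
  exact hyO.2.1 (hno τ hτ x y (SameCycle.refl _ _) h3 h4)

end Digraph

/-! ### Tight sets of classes -/

namespace Digraph

section

variable {V ι : Type*}

open Classical in
/-- The number of vertices of `U` whose class lies in `S`. -/
noncomputable def mass (c : V → ι) (U : Finset V) (S : Set ι) : ℕ :=
  (U.filter fun x => c x ∈ S).card

/-- The out-neighbourhood of a set of vertices. -/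
def outNbr (T : Digraph ι) (S : Set ι) : Set ι := {j | ∃ i ∈ S, T.Adj i j}

variable {T : Digraph ι} {c : V → ι} {U : Finset V}

theorem mass_mono {S S' : Set ι} (h : S ⊆ S') : mass c U S ≤ mass c U S' := by
  classical
  exact Finset.card_le_card (Finset.monotone_filter_right U fun _ _ hx => h hx)

theorem mass_union {S S' : Set ι} (h : Disjoint S S') :
    mass c U (S ∪ S') = mass c U S + mass c U S' := by
  classical
  rw [mass, mass, mass, ← Finset.card_union_of_disjoint]
  · congr 1
    ext x
    simp only [Finset.mem_filter, Finset.mem_union, Set.mem_union]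
    tauto
  · rw [Finset.disjoint_filter]
    exact fun x _ h1 h2 => Set.disjoint_left.1 h h1 h2

theorem mass_pos {S : Set ι} {x : V} (hx : x ∈ U) (hxS : c x ∈ S) : 0 < mass c U S := by
  classical
  exact Finset.card_pos.2 ⟨x, by simp [hx, hxS]⟩

theorem IsFactor.mass_le {σ : Perm V} (h : IsFactor T c U σ) (S : Set ι) :
    mass c U S ≤ mass c U (outNbr T S) := by
  classical
  refine Finset.card_le_card_of_injOn σ (fun x hx => ?_) σ.injective.injOn
  simp only [Finset.coe_filter, Set.mem_ofPred_eq] at hx ⊢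
  exact ⟨h.apply_mem hx.1, c x, hx.2, h.adj x hx.1⟩

/-- In a factor, only vertices of a tight set `S` are followed by vertices of its
out-neighbourhood. -/
theorem IsFactor.mem_of_tight {σ : Perm V} (h : IsFactor T c U σ) {S : Set ι}
    (hS : mass c U S = mass c U (outNbr T S)) {x : V} (hx : x ∈ U)
    (hσx : c (σ x) ∈ outNbr T S) : c x ∈ S := by
  classical
  have hsub : (U.filter fun x => c x ∈ S).map σ.toEmbedding ⊆
      U.filter fun x => c x ∈ outNbr T S := by
    intro y hy
    simp only [Finset.mem_map, Finset.mem_filter] at hy ⊢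
    obtain ⟨x, ⟨hx, hxS⟩, rfl⟩ := hy
    exact ⟨h.apply_mem hx, c x, hxS, h.adj x hx⟩
  have heq := Finset.eq_of_subset_of_card_le hsub (by rw [Finset.card_map]; exact hS.ge)
  have hmem : σ x ∈ U.filter fun x => c x ∈ outNbr T S :=
    Finset.mem_filter.2 ⟨h.apply_mem hx, hσx⟩
  rw [← heq] at hmem
  simp only [Finset.mem_map, Finset.mem_filter] at hmem
  obtain ⟨y, hy, hyx⟩ := hmem
  rw [← σ.injective hyx]
  exact hy.2

/-- Hall's theorem: if deleting `v` destroys all cycle factors, then there is a tight set of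
classes whose out-neighbourhood contains the class of `v`, although it does not contain it. -/
theorem IsFactor.exists_tight [Finite V] [DecidableEq V] {σ : Perm V} (h : IsFactor T c U σ) {v : V}
    (hv : v ∈ U) (hno : ¬ ∃ τ, IsFactor T c (U.erase v) τ) :
    ∃ S, mass c U S = mass c U (outNbr T S) ∧ c v ∈ outNbr T S ∧ c v ∉ S := by
  classical
  let t : U.erase v → Finset V := fun x => (U.erase v).filter fun y => T.Adj (c x) (c y)
  have hfail : ¬ ∀ s : Finset (U.erase v), s.card ≤ (s.biUnion t).card := by
    rw [Finset.all_card_le_biUnion_card_iff_exists_injective]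
    rintro ⟨f, hf, hft⟩
    have hfU : ∀ x, f x ∈ U.erase v := fun x => (Finset.mem_filter.1 (hft x)).1
    have hinj : Function.Injective fun x : V => if hx : x ∈ U.erase v then f ⟨x, hx⟩ else x := by
      intro x y hxy
      simp only at hxy
      split_ifs at hxy with hx hy hy
      · exact congrArg Subtype.val (hf hxy)
      · exact absurd (hxy ▸ hfU _) hy
      · exact absurd (hxy ▸ hfU _) hx
      · exact hxy
    refine hno ⟨Equiv.ofBijective _ (Finite.injective_iff_bijective.1 hinj),
      fun x hx => ?_, fun x hx => ?_⟩
    · simp only [ofBijective_apply, dif_pos hx]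
      exact (Finset.mem_filter.1 (hft ⟨x, hx⟩)).2
    · simp only [ofBijective_apply, dif_neg hx]
  push Not at hfail
  obtain ⟨s, hs⟩ := hfail
  obtain ⟨S, hS⟩ : ∃ S : Set ι, ∀ i, i ∈ S ↔ ∃ x ∈ s, c x.1 = i := ⟨{i | _}, fun _ => Iff.rfl⟩
  have h1 := h.mass_le S
  have hsS : s.map (Function.Embedding.subtype _) ⊆ (U.filter fun x => c x ∈ S).erase v := by
    intro y hy
    obtain ⟨x, hx, rfl⟩ := Finset.mem_map.1 hy
    have := Finset.mem_erase.1 x.2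
    simp only [Function.Embedding.subtype_apply, Finset.mem_erase, Finset.mem_filter]
    exact ⟨this.1, this.2, (hS _).2 ⟨x, hx, rfl⟩⟩
  have h2 := Finset.card_le_card hsS
  rw [Finset.card_map] at h2
  have h3 : ((U.filter fun x => c x ∈ outNbr T S).erase v) ⊆ s.biUnion t := by
    intro y hy
    simp only [Finset.mem_erase, Finset.mem_filter] at hy
    obtain ⟨hyv, hyU, i, hi, hxy⟩ := hy
    obtain ⟨x, hx, rfl⟩ := (hS i).1 hi
    exact Finset.mem_biUnion.2 ⟨x, hx, Finset.mem_filter.2 ⟨Finset.mem_erase.2 ⟨hyv, hyU⟩, hxy⟩⟩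
  have h4 := Finset.card_le_card h3
  have h5 : ((U.filter fun x => c x ∈ S).erase v).card ≤ mass c U S :=
    Finset.card_le_card (Finset.erase_subset _ _)
  have h6 : mass c U (outNbr T S) - 1 ≤ ((U.filter fun x => c x ∈ outNbr T S).erase v).card :=
    Finset.pred_card_le_card_erase
  refine ⟨S, by omega, ?_, fun hvS => ?_⟩
  · by_contra hvN
    rw [Finset.erase_eq_of_notMem (by simp [hvN])] at h4
    change mass c U (outNbr T S) ≤ _ at h4
    omega
  · have h7 : ((U.filter fun x => c x ∈ S).erase v).card < mass c U S :=
      Finset.card_erase_lt_of_mem (by simp [hv, hvS])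
    omega

/-- A tight set `S` whose out-neighbourhood arises from it by exchanging a class `p` for a class `v`
outside `S` of the same size. -/
structure IsTightExchange (T : Digraph ι) (c : V → ι) (U : Finset V) (S : Set ι) (p v : ι) :
    Prop where
  mem : p ∈ S
  notMem : v ∉ S
  out : outNbr T S = insert v (S \ {p})
  tight : mass c U S = mass c U (outNbr T S)
  mass_eq : mass c U {p} = mass c U {v}

/-- A tight set whose out-neighbourhood contains a class `v` of maximum size outside of it differs
from that out-neighbourhood by one exchange: a class without in-arcs from the tight set is unique
by semicompleteness, and it must make up for all the classes gained. -/
theorem exists_isTightExchange (hs : T.IsSemicomplete) (hhit : ∀ i, ∃ x ∈ U, c x = i) {S : Set ι}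
    (hS : mass c U S = mass c U (outNbr T S)) {v : ι} (hvN : v ∈ outNbr T S) (hvS : v ∉ S)
    (hmax : ∀ i, mass c U {i} ≤ mass c U {v}) : ∃ p, IsTightExchange T c U S p v := by
  have hposi : ∀ i, 0 < mass c U {i} := fun i => by
    obtain ⟨x, hx, hxi⟩ := hhit i
    exact mass_pos hx hxi
  have e1 : mass c U S = mass c U (S ∩ outNbr T S) + mass c U (S \ outNbr T S) := by
    rw [← mass_union (Set.disjoint_left.2 fun x h1 h2 => h2.2 h1.2), Set.inter_union_sdiff]
  have e2 : mass c U (outNbr T S) = mass c U (S ∩ outNbr T S) + mass c U (outNbr T S \ S) := by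
    rw [Set.inter_comm, ← mass_union (Set.disjoint_left.2 fun x h1 h2 => h2.2 h1.2),
      Set.inter_union_sdiff]
  have e3 : mass c U {v} ≤ mass c U (outNbr T S \ S) :=
    mass_mono (Set.singleton_subset_iff.2 ⟨hvN, hvS⟩)
  have hsub : (S \ outNbr T S).Subsingleton := by
    intro i hi j hj
    by_contra hij
    rcases hs i j hij with h | h
    · exact hj.2 ⟨i, hi.1, h⟩
    · exact hi.2 ⟨j, hj.1, h⟩
  have hne : (S \ outNbr T S).Nonempty := by
    rw [Set.nonempty_iff_ne_empty]
    intro h0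
    have : mass c U (∅ : Set ι) = 0 := by simp [mass]
    rw [h0, this] at e1
    have := hposi v
    omega
  obtain ⟨p, hp⟩ := hne
  have hSp : S \ outNbr T S = {p} := hsub.eq_singleton_of_mem hp
  rw [hSp] at e1
  have hNv : outNbr T S \ S = {v} := by
    refine Set.eq_singleton_iff_unique_mem.2 ⟨⟨hvN, hvS⟩, fun j hj => ?_⟩
    by_contra hjv
    have h1 : mass c U ({v} ∪ {j}) ≤ mass c U (outNbr T S \ S) := by
      refine mass_mono ?_
      rintro i (rfl | rfl)
      exacts [⟨hvN, hvS⟩, hj]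
    rw [mass_union (by simpa using Ne.symm hjv)] at h1
    have := hposi j
    have := hmax p
    omega
  refine ⟨p, hp.1, hvS, ?_, hS, ?_⟩
  · ext j
    by_cases hjS : j ∈ S
    · have h1 : j ∈ S \ outNbr T S ↔ j = p := by rw [hSp]; rfl
      have h2 : j ≠ v := by rintro rfl; exact hvS hjS
      simp only [Set.mem_sdiff, hjS, true_and, Set.mem_insert_iff, h2, false_or,
        Set.mem_singleton_iff] at h1 ⊢
      tauto
    · have h1 : j ∈ outNbr T S \ S ↔ j = v := by rw [hNv]; rfl
      simp only [Set.mem_sdiff, hjS, not_false_eq_true, and_true, Set.mem_insert_iff, false_and,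
        or_false] at h1 ⊢
      exact h1
  · rw [hNv] at e2
    omega

namespace IsTightExchange

variable {S : Set ι} {p v : ι}

theorem ne (h : IsTightExchange T c U S p v) : p ≠ v := by
  rintro rfl; exact h.notMem h.mem

theorem eq_or_mem (h : IsTightExchange T c U S p v) {i j : ι} (hi : i ∈ S) (hij : T.Adj i j) :
    j = v ∨ j ∈ S ∧ j ≠ p := by
  have : j ∈ outNbr T S := ⟨i, hi, hij⟩
  rw [h.out] at this
  exact this

theorem adj_of_notMem (h : IsTightExchange T c U S p v) (hs : T.IsSemicomplete) {i j : ι}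
    (hi : i ∈ S) (hj : j ∉ S) (hjv : j ≠ v) : T.Adj j i ∧ ¬ T.Adj i j := by
  have h1 : ¬ T.Adj i j := fun h1 => (h.eq_or_mem hi h1).elim hjv fun h2 => hj h2.1
  exact ⟨(hs j i (by rintro rfl; exact hj hi)).resolve_right h1, h1⟩

theorem adj_of_ne (h : IsTightExchange T c U S p v) (hs : T.IsSemicomplete) {i : ι}
    (hi : i ∈ S) (hip : i ≠ p) : T.Adj p i ∧ ¬ T.Adj i p := by
  have h1 : ¬ T.Adj i p := fun h1 => (h.eq_or_mem hi h1).elim h.ne fun h2 => h2.2 rfl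
  exact ⟨(hs p i hip.symm).resolve_right h1, h1⟩

end IsTightExchange

end

end Digraph

/-! ### Blow-ups and cycles alternating between two classes -/

namespace Digraph

/-- The blow-up of `T` along `c`: each vertex `i` of `T` is replaced by the independent set
`c ⁻¹' {i}`. -/
def blowUp {V ι : Type*} (T : Digraph ι) (c : V → ι) : Digraph V where
  Adj x y := T.Adj (c x) (c y)

variable {V ι : Type*} {D : Digraph V}

/-- The relation between a composition and its quotient: arcs between different classes of `c` are
governed by `T`. -/
def IsCompositionOver {V ι : Type*} (D : Digraph V) (T : Digraph ι) (c : V → ι) : Prop :=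
  ∀ x y, c x ≠ c y → (D.Adj x y ↔ T.Adj (c x) (c y))

theorem IsCompositionOver.adj_of_blowUp {T : Digraph ι} {c : V → ι}
    (hD : D.IsCompositionOver T c) (hl : T.IsLoopless)
    (x y : V) (h : (T.blowUp c).Adj x y) : D.Adj x y :=
  (hD x y fun hxy => hl (c x) (by
    change T.Adj (c x) (c y) at h
    rwa [← hxy] at h)).2 h

variable [Fintype V] [DecidableEq V]

theorem IsCyclePerm.isFactor {T : Digraph ι} {c : V → ι} {σ : Perm V}
    (h : (T.blowUp c).IsCyclePerm σ) : IsFactor T c σ.support σ :=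
  ⟨h.adj, fun _ hx => notMem_support.1 hx⟩

/-- All vertices of a cycle satisfy a property which holds for one of them and propagates from each
vertex to its successor. -/
theorem IsCyclePerm.forall_of_closed {σ : Perm V} (h : D.IsCyclePerm σ) {P : V → Prop} {x : V}
    (hx : x ∈ σ.support) (hPx : P x) (hP : ∀ x ∈ σ.support, P x → P (σ x)) :
    ∀ y ∈ σ.support, P y := by
  intro y hy
  by_contra hPy
  refine not_sameCycle_of_closed (σ := σ) (S := {z | z ∈ σ.support ∧ P z})
    (fun z hz => ⟨apply_mem_support.2 hz.1, hP z hz.1 hz.2⟩) ⟨hx, hPx⟩ (fun h => hPy h.2)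
    (h.isCycle.sameCycle (mem_support.1 hx) (mem_support.1 hy))

/-- A cycle on which a property holds somewhere and fails somewhere has an arc along which it
ceases to hold. -/
theorem IsCyclePerm.exists_and_not_apply {σ : Perm V} (h : D.IsCyclePerm σ) {P : V → Prop} {x y : V}
    (hx : x ∈ σ.support) (hPx : P x) (hy : y ∈ σ.support) (hPy : ¬ P y) :
    ∃ z ∈ σ.support, P z ∧ ¬ P (σ z) := by
  by_contra! hcon
  exact hPy (h.forall_of_closed hx hPx hcon y hy)

/-- In a complete bipartite digraph with parts `A` and `B` there are cycles of each even length
`2 * j` with `j ≤ |A|, |B|`, and they can be taken through any given vertex of `A`. -/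
theorem exists_alternating {A B : Finset V} (hAB : Disjoint A B)
    (h1 : ∀ a ∈ A, ∀ b ∈ B, D.Adj a b ∧ D.Adj b a) {a₀ : V} (ha₀ : a₀ ∈ A) {j : ℕ} (hj : 1 ≤ j)
    (hjA : j ≤ A.card) (hjB : j ≤ B.card) :
    ∃ τ : Perm V, D.IsCyclePerm τ ∧ τ.support ⊆ A ∪ B ∧ a₀ ∈ τ.support ∧
      (τ.support ∩ A).card = j ∧ (τ.support ∩ B).card = j ∧
      (∀ x ∈ τ.support, x ∈ A → τ x ∈ B) ∧ ∀ x ∈ τ.support, x ∈ B → τ x ∈ A := by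
  have hd : ∀ {x}, x ∈ A → x ∉ B := fun h h' => Finset.disjoint_left.1 hAB h h'
  induction j, hj using Nat.le_induction with
  | base =>
    obtain ⟨b, hb⟩ := Finset.card_pos.1 (by omega : 0 < B.card)
    have hne : a₀ ≠ b := by rintro rfl; exact hd ha₀ hb
    refine ⟨swap a₀ b, isCyclePerm_swap hne (h1 _ ha₀ _ hb).1 (h1 _ ha₀ _ hb).2, ?_⟩
    have e1 : ({a₀, b} : Finset V) ∩ A = {a₀} := by
      ext x
      simp only [Finset.mem_inter, Finset.mem_insert, Finset.mem_singleton]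
      constructor
      · rintro ⟨rfl | rfl, hx⟩
        exacts [rfl, absurd hb (hd hx)]
      · rintro rfl; exact ⟨Or.inl rfl, ha₀⟩
    have e2 : ({a₀, b} : Finset V) ∩ B = {b} := by
      ext x
      simp only [Finset.mem_inter, Finset.mem_insert, Finset.mem_singleton]
      constructor
      · rintro ⟨rfl | rfl, hx⟩
        exacts [absurd hx (hd ha₀), rfl]
      · rintro rfl; exact ⟨Or.inr rfl, hb⟩
    rw [support_swap hne, e1, e2]
    refine ⟨?_, by simp, by simp, by simp, ?_, ?_⟩
    · intro x hx
      simp only [Finset.mem_insert, Finset.mem_singleton] at hx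
      rcases hx with rfl | rfl <;> simp [ha₀, hb]
    · intro x hx hxA
      simp only [Finset.mem_insert, Finset.mem_singleton] at hx
      rcases hx with rfl | rfl
      · simpa using hb
      · exact absurd hb (hd hxA)
    · intro x hx hxB
      simp only [Finset.mem_insert, Finset.mem_singleton] at hx
      rcases hx with rfl | rfl
      · exact absurd hxB (hd ha₀)
      · simpa using ha₀
  | succ j hj ih =>
    obtain ⟨τ, h, hsub, h0, hcA, hcB, hA, hB⟩ := ih (by omega) (by omega)
    have hex : ∀ C : Finset V, (τ.support ∩ C).card = j → j + 1 ≤ C.card →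
        ∃ x ∈ C, x ∉ τ.support := by
      intro C h1 h2
      by_contra! hcon
      rw [Finset.inter_eq_right.2 hcon] at h1
      omega
    obtain ⟨a, haA, ha⟩ := hex A hcA hjA
    obtain ⟨b, hbB, hb⟩ := hex B hcB hjB
    have hτ0 : τ a₀ ∈ B := hA a₀ h0 ha₀
    have hτ0s : τ a₀ ∈ τ.support := apply_mem_support.2 h0
    have hab : a ≠ b := by rintro rfl; exact hd haA hbB
    obtain ⟨τ₁, g1, s1, e1, e2, e3, f1⟩ := h.exists_insert_two ha hb hab hτ0s (h1 a haA _ hτ0).2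
      (h1 a haA b hbB).1 (h1 _ (hB _ hτ0s hτ0) b hbB).2
    refine ⟨τ₁, g1, ?_, by simp [s1, h0], ?_, ?_, ?_, ?_⟩
    · rw [s1, Finset.insert_subset_iff, Finset.insert_subset_iff]
      exact ⟨Finset.mem_union_right _ hbB, Finset.mem_union_left _ haA, hsub⟩
    · rw [s1, Finset.insert_inter_of_notMem (fun h => hd h hbB), Finset.insert_inter_of_mem haA,
        Finset.card_insert_of_notMem (by simp [ha]), hcA]
    · rw [s1, Finset.insert_inter_of_mem hbB, Finset.insert_inter_of_notMem (hd haA),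
        Finset.card_insert_of_notMem (by simp [hb]), hcB]
    · intro x hx hxA
      by_cases hxa : x = a
      · rw [hxa, e2]; exact hbB
      have hxb : x ≠ b := by rintro rfl; exact hd hxA hbB
      rw [f1 x (by rintro rfl; exact hd hxA hτ0) hxa hxb]
      rw [s1, Finset.mem_insert, Finset.mem_insert] at hx
      exact hA x (by tauto) hxA
    · intro x hx hxB
      by_cases hxb : x = b
      · rw [hxb, e3]; exact hB _ hτ0s hτ0
      by_cases hx0 : x = τ a₀
      · rw [hx0, e1]; exact haA
      have hxa : x ≠ a := by rintro rfl; exact hd haA hxB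
      rw [f1 x hx0 hxa hxb]
      rw [s1, Finset.mem_insert, Finset.mem_insert] at hx
      exact hB x (by tauto) hxB

theorem exists_cyclicOn_even {A B : Finset V} (hAB : Disjoint A B)
    (h1 : ∀ a ∈ A, ∀ b ∈ B, D.Adj a b ∧ D.Adj b a) {j : ℕ} (hj : 1 ≤ j)
    (hjA : j ≤ A.card) (hjB : j ≤ B.card) : ∃ W : Finset V, W.card = 2 * j ∧ D.CyclicOn W := by
  obtain ⟨a₀, ha₀⟩ := Finset.card_pos.1 (by omega : 0 < A.card)
  obtain ⟨τ, h, hsub, -, hcA, hcB, -⟩ := exists_alternating hAB h1 ha₀ hj hjA hjB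
  refine ⟨_, ?_, h.cyclicOn⟩
  rw [← Finset.inter_eq_left.2 hsub, Finset.inter_union_distrib_left,
    Finset.card_union_of_disjoint, hcA, hcB]
  · omega
  · exact hAB.mono Finset.inter_subset_right Finset.inter_subset_right

/-- An alternating cycle through `a₀` can be lengthened by a vertex `z` that is dominated by `B`
and dominates `a₀`. -/
theorem exists_cyclicOn_odd {A B : Finset V} (hAB : Disjoint A B)
    (h1 : ∀ a ∈ A, ∀ b ∈ B, D.Adj a b ∧ D.Adj b a) {a₀ z : V} (ha₀ : a₀ ∈ A) (hzA : z ∉ A)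
    (hzB : z ∉ B) (hBz : ∀ b ∈ B, D.Adj b z) (hz : D.Adj z a₀) {j : ℕ} (hj : 1 ≤ j)
    (hjA : j ≤ A.card) (hjB : j ≤ B.card) :
    ∃ W : Finset V, W.card = 2 * j + 1 ∧ D.CyclicOn W := by
  obtain ⟨τ, h, hsub, h0, hcA, hcB, hA, hB⟩ := exists_alternating hAB h1 ha₀ hj hjA hjB
  have hb : τ.symm a₀ ∈ τ.support := by rw [← apply_mem_support, apply_symm_apply]; exact h0
  have hbB : τ.symm a₀ ∈ B := by
    refine (Finset.mem_union.1 (hsub hb)).resolve_left fun hbA => ?_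
    have := hA _ hb hbA
    rw [apply_symm_apply] at this
    exact Finset.disjoint_left.1 hAB ha₀ this
  have hzs : z ∉ τ.support := fun hzs => (Finset.mem_union.1 (hsub hzs)).elim hzA hzB
  obtain ⟨τ', h', s', -⟩ := h.exists_insert hzs hb (hBz _ hbB) (by rwa [apply_symm_apply])
  refine ⟨_, ?_, h'.cyclicOn⟩
  rw [s', Finset.card_insert_of_notMem hzs, ← Finset.inter_eq_left.2 hsub,
    Finset.inter_union_distrib_left, Finset.card_union_of_disjoint, hcA, hcB]
  · omega
  · exact hAB.mono Finset.inter_subset_right Finset.inter_subset_right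

end Digraph

/-! ### Deleting a vertex from a Hamiltonian blow-up -/

namespace Digraph

theorem IsTriangularWith.of_strictlyDominates {V : Type*} {D : Digraph V} {A B C : Set V}
    (hA : A.Nonempty) (hB : B.Nonempty) (hC : C.Nonempty) (hcov : ∀ x, x ∈ A ∨ x ∈ B ∨ x ∈ C)
    (hAB : D.StrictlyDominates A B) (hBC : D.StrictlyDominates B C)
    (hCA : D.StrictlyDominates C A) : D.IsTriangularWith ![A, B, C] := by
  have hdis : ∀ {X Y : Set V}, D.StrictlyDominates X Y → Disjoint X Y := fun h =>
    Set.disjoint_left.2 fun x hx hy => (h x hx x hy).2 (h x hx x hy).1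
  refine ⟨?_, ?_, ?_, hAB, hBC, hCA⟩
  · intro i; fin_cases i <;> assumption
  · intro i j hij
    fin_cases i <;> fin_cases j
    · exact absurd rfl hij
    · exact hdis hAB
    · exact (hdis hCA).symm
    · exact (hdis hAB).symm
    · exact absurd rfl hij
    · exact hdis hBC
    · exact hdis hCA
    · exact (hdis hBC).symm
    · exact absurd rfl hij
  · refine Set.eq_univ_of_forall fun x => Set.mem_iUnion.2 ?_
    rcases hcov x with h | h | h
    exacts [⟨0, h⟩, ⟨1, h⟩, ⟨2, h⟩]

variable {V ι : Type*} {T : Digraph ι} {c : V → ι} {U : Finset V}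

/-- If `p` is exchanged for `v` by one tight set and `v` for `p` by another, then one of the two
tight sets is a singleton, and the other one consists of all other classes. -/
theorem IsTightExchange.eq_singleton_or (hs : T.IsSemicomplete) (hst : T.IsStronglyConnected)
    {S S' : Set ι} {p v : ι} (h : IsTightExchange T c U S p v)
    (h' : IsTightExchange T c U S' v p) : (S = {p} ∧ S' = {p}ᶜ) ∨ (S' = {v} ∧ S = {v}ᶜ) := by
  -- nothing enters the complement of `S ∪ S'`
  have hcov : ∀ i, i ∈ S ∨ i ∈ S' := by
    by_contra! hcon
    obtain ⟨i₀, h1, h2⟩ := hcon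
    obtain ⟨i, hi, j, hj, hij⟩ := hst (S ∪ S') ⟨p, Or.inl h.mem⟩ ⟨i₀, by simp [h1, h2]⟩
    simp only [Set.mem_union, not_or] at hj
    rcases hi with hi | hi
    · rcases h.eq_or_mem hi hij with rfl | h3
      exacts [hj.2 h'.mem, hj.1 h3.1]
    · rcases h'.eq_or_mem hi hij with rfl | h3
      exacts [hj.1 h.mem, hj.2 h3.1]
  -- if all of `S` except `p` lies in `S'`, then no arc leaves `S \ {p}`
  have hone : ∀ {S S' : Set ι} {p v : ι}, IsTightExchange T c U S p v →
      IsTightExchange T c U S' v p → (∀ i, i ∈ S ∨ i ∈ S') → (∀ i ∈ S, i ≠ p → i ∈ S') →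
      S = {p} ∧ S' = {p}ᶜ := by
    intro S S' p v h h' hcov hsub
    have hS : S = {p} := by
      by_contra hne
      obtain ⟨i₀, hi₀, hi₀p⟩ : ∃ i ∈ S, i ≠ p := by
        by_contra! hcon
        exact hne (Set.eq_singleton_iff_unique_mem.2 ⟨h.mem, hcon⟩)
      obtain ⟨i, hi, j, hj, hij⟩ := hst (S \ {p}) ⟨i₀, hi₀, hi₀p⟩ ⟨p, by simp⟩
      rcases h.eq_or_mem hi.1 hij with rfl | h3
      · exact (h'.adj_of_ne hs (hsub i hi.1 hi.2) (by rintro rfl; exact h.notMem hi.1)).2 hij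
      · exact hj h3
    refine ⟨hS, Set.ext fun i => ?_⟩
    rw [Set.mem_compl_iff, Set.mem_singleton_iff]
    constructor
    · rintro hi rfl; exact h'.notMem hi
    · intro hip
      exact (hcov i).resolve_left (by rw [hS]; exact hip)
  by_cases hsub : ∀ i ∈ S, i ≠ p → i ∈ S'
  · exact Or.inl (hone h h' hcov hsub)
  · push Not at hsub
    obtain ⟨i, hi, hip, hi'⟩ := hsub
    refine Or.inr (hone h' h (fun i => (hcov i).symm) fun z hz hzv => ?_)
    by_contra hzS
    exact (h.adj_of_notMem hs hi hzS hzv).2 (h'.adj_of_notMem hs hz hi' hip).1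

/-- `p` and `q` form a digon, and every other class lies on paths `q → z → p`, but sends no arc
to `q` and receives none from `p`. -/
structure IsDigonHub (T : Digraph ι) (p q : ι) : Prop where
  ne : p ≠ q
  adj : T.Adj p q
  adj' : T.Adj q p
  adj_left : ∀ z, z ≠ p → z ≠ q → T.Adj q z
  adj_right : ∀ z, z ≠ p → z ≠ q → T.Adj z p
  not_adj_left : ∀ z, z ≠ p → z ≠ q → ¬ T.Adj z q
  not_adj_right : ∀ z, z ≠ p → z ≠ q → ¬ T.Adj p z

/-- Mutual tight exchanges through a singleton make `p`, `v` a digon hub, unless `v ↛ p`, in which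
case `{v}`, the remaining vertices, and `{p}` form a triangular partition. -/
theorem IsTightExchange.isDigonHub (hs : T.IsSemicomplete) {S' : Set ι} {p v : ι}
    (h : IsTightExchange T c U {p} p v) (h' : IsTightExchange T c U S' v p) (hS' : S' = {p}ᶜ)
    (h3 : ∃ z, z ≠ p ∧ z ≠ v) (hntri : ¬ ∃ P : Fin 3 → Set ι, T.IsTriangularWith P) :
    IsDigonHub T p v := by
  have hr : ∀ z, z ≠ p → z ≠ v → T.Adj z p ∧ ¬ T.Adj p z := fun z hzp hzv =>
    h.adj_of_notMem hs h.mem hzp hzv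
  have hl : ∀ z, z ≠ p → z ≠ v → T.Adj v z ∧ ¬ T.Adj z v := fun z hzp hzv =>
    h'.adj_of_ne hs (by rw [hS']; exact hzp) hzv
  have hpv : T.Adj p v := by
    have : v ∈ outNbr T {p} := by rw [h.out]; exact Set.mem_insert _ _
    obtain ⟨i, hi, hiv⟩ := this
    rwa [Set.mem_singleton_iff.1 hi] at hiv
  refine ⟨h.ne, hpv, ?_, fun z h1 h2 => (hl z h1 h2).1, fun z h1 h2 => (hr z h1 h2).1,
    fun z h1 h2 => (hl z h1 h2).2, fun z h1 h2 => (hr z h1 h2).2⟩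
  by_contra hvp
  refine hntri ⟨_, IsTriangularWith.of_strictlyDominates (A := {v}) (B := {z | z ≠ p ∧ z ≠ v})
    (C := {p}) ⟨v, rfl⟩ h3 ⟨p, rfl⟩ ?_ ?_ ?_ ?_⟩
  · intro x
    by_cases hxv : x = v
    · exact Or.inl hxv
    by_cases hxp : x = p
    · exact Or.inr (Or.inr hxp)
    · exact Or.inr (Or.inl ⟨hxp, hxv⟩)
  · rintro _ rfl z hz; exact hl z hz.1 hz.2
  · rintro z hz _ rfl; exact hr z hz.1 hz.2
  · rintro _ rfl _ rfl; exact ⟨hpv, hvp⟩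

theorem mass_singleton_eq [DecidableEq ι] (i : ι) :
    mass c U {i} = (U.filter fun x => c x = i).card := by
  unfold mass
  congr 1
  ext x
  simp

theorem IsFactor.symm_mem {σ : Perm V} (h : IsFactor T c U σ) {x : V} (hx : x ∈ U) :
    σ.symm x ∈ U := by
  by_contra h0
  have := h.fixed _ h0
  rw [apply_symm_apply] at this
  exact h0 (this ▸ hx)

theorem mass_erase_of_ne [DecidableEq V] {y : V} {i : ι} (hy : c y ≠ i) :
    mass c (U.erase y) {i} = mass c U {i} := by
  classical
  rw [mass_singleton_eq, mass_singleton_eq]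
  congr 1
  ext x
  simp only [Finset.mem_filter, Finset.mem_erase]
  constructor
  · rintro ⟨⟨-, h1⟩, h2⟩; exact ⟨h1, h2⟩
  · rintro ⟨h1, h2⟩; exact ⟨⟨by rintro rfl; exact hy h2, h1⟩, h2⟩

/-- If every vertex of class `j` is preceded by one of class `i`, and the two classes have the same
size, then every vertex of class `i` is followed by one of class `j`. -/
theorem IsFactor.forall_apply_of_mass_eq {σ : Perm V} (h : IsFactor T c U σ) {i j : ι}
    (hm : mass c U {i} = mass c U {j}) (hij : ∀ y ∈ U, c y = j → c (σ.symm y) = i) :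
    ∀ x ∈ U, c x = i → c (σ x) = j := by
  classical
  rw [mass_singleton_eq, mass_singleton_eq] at hm
  intro x hx hxi
  have hsub : (U.filter fun x => c x = j).map σ.symm.toEmbedding ⊆ U.filter fun x => c x = i := by
    intro y hy
    obtain ⟨x, hx, rfl⟩ := Finset.mem_map.1 hy
    obtain ⟨hx, hxi⟩ := Finset.mem_filter.1 hx
    exact Finset.mem_filter.2 ⟨h.symm_mem hx, hij x hx hxi⟩
  have heq := Finset.eq_of_subset_of_card_le hsub (by rw [Finset.card_map]; exact hm.le)
  have hmem : x ∈ U.filter fun x => c x = i := Finset.mem_filter.2 ⟨hx, hxi⟩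
  rw [← heq] at hmem
  obtain ⟨y, hy, rfl⟩ := Finset.mem_map.1 hmem
  simpa using (Finset.mem_filter.1 hy).2

variable [Fintype V] [DecidableEq V]

theorem IsCyclePerm.isStronglyConnected {σ : Perm V} (hσ : (T.blowUp c).IsCyclePerm σ)
    (hhit : ∀ i, ∃ x ∈ σ.support, c x = i) : T.IsStronglyConnected := by
  rintro S ⟨i, hi⟩ ⟨j, hj⟩
  obtain ⟨x, hx, rfl⟩ := hhit i
  obtain ⟨y, hy, rfl⟩ := hhit j
  obtain ⟨z, hz, h1, h2⟩ := hσ.exists_and_not_apply (P := fun x => c x ∈ S) hx hi hy hj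
  exact ⟨_, h1, _, h2, hσ.adj z hz⟩

/-- If a Hamiltonian cycle of a blow-up only goes `a → b → d → a`, then `T` is triangular. -/
theorem IsCyclePerm.isTriangularWith {σ : Perm V} (hσ : (T.blowUp c).IsCyclePerm σ)
    (hhit : ∀ i, ∃ x ∈ σ.support, c x = i) {a b d : ι}
    (hab : ∀ x ∈ σ.support, c x = a → c (σ x) = b) (hbd : ∀ x ∈ σ.support, c x = b → c (σ x) = d)
    (hda : ∀ x ∈ σ.support, c x = d → c (σ x) = a) (nab : ¬ T.Adj b a) (nbd : ¬ T.Adj d b)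
    (nda : ¬ T.Adj a d) : ∃ P : Fin 3 → Set ι, T.IsTriangularWith P := by
  have hadj : ∀ {i j}, (∀ x ∈ σ.support, c x = i → c (σ x) = j) → T.Adj i j := by
    intro i j hij
    obtain ⟨x, hx, rfl⟩ := hhit i
    have := hσ.adj x hx
    rw [← hij x hx rfl]
    exact this
  refine ⟨_, IsTriangularWith.of_strictlyDominates (A := {a}) (B := {b}) (C := {d}) ⟨a, rfl⟩
    ⟨b, rfl⟩ ⟨d, rfl⟩ (fun i => ?_) ?_ ?_ ?_⟩
  · obtain ⟨x, hx, hxa⟩ := hhit a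
    obtain ⟨y, hy, rfl⟩ := hhit i
    refine hσ.forall_of_closed (P := fun x => c x = a ∨ c x = b ∨ c x = d) hx (Or.inl hxa) ?_ y hy
    rintro z hz (h | h | h)
    exacts [Or.inr (Or.inl (hab z hz h)), Or.inr (Or.inr (hbd z hz h)), Or.inl (hda z hz h)]
  · rintro _ rfl _ rfl; exact ⟨hadj hab, nab⟩
  · rintro _ rfl _ rfl; exact ⟨hadj hbd, nbd⟩
  · rintro _ rfl _ rfl; exact ⟨hadj hda, nda⟩

/-- Consider tight exchanges of `p` for `v` and of `p'` for `p`, where `p' ≠ v`. If no vertex of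
class `p'` can be skipped on the Hamiltonian cycle, then `T` is a triangle on `p`, `p'`, `v`. -/
theorem IsTightExchange.isTriangularWith (hs : T.IsSemicomplete) {σ : Perm V}
    (hσ : (T.blowUp c).IsCyclePerm σ) (hhit : ∀ i, ∃ x ∈ σ.support, c x = i) {S S' : Set ι}
    {p p' v : ι} (h : IsTightExchange T c σ.support S p v)
    (h' : IsTightExchange T c σ.support S' p' p) (hne : p' ≠ v)
    (hskip : ∀ y ∈ σ.support, c y = p' → ¬ T.Adj (c (σ.symm y)) (c (σ y))) :
    ∃ P : Fin 3 → Set ι, T.IsTriangularWith P := by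
  have hst := hσ.isStronglyConnected hhit
  have hf := hσ.isFactor
  have hpred : ∀ y ∈ σ.support, T.Adj (c (σ.symm y)) (c y) := fun y hy => by
    simpa using hf.adj _ (hf.symm_mem hy)
  -- predecessors of `p'` lie outside `S'`, successors in `(S' \ {p'}) ∪ {p}`
  have hx' : ∀ y ∈ σ.support, c y = p' → c (σ.symm y) ∉ S' := fun y hy hyp hx => by
    rcases h'.eq_or_mem hx (hyp ▸ hpred y hy) with h1 | h1
    exacts [h'.ne h1, h1.2 rfl]
  have hz' : ∀ y ∈ σ.support, c y = p' → c (σ y) = p ∨ c (σ y) ∈ S' ∧ c (σ y) ≠ p' :=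
    fun y hy hyp => h'.eq_or_mem h'.mem (hyp ▸ hf.adj y hy)
  have hor : ∀ y ∈ σ.support, c y = p' → c (σ.symm y) = p ∨ c (σ y) = p := by
    intro y hy hyp
    by_contra! hcon
    exact hskip y hy hyp (h'.adj_of_notMem hs ((hz' y hy hyp).resolve_left hcon.2).1
      (hx' y hy hyp) hcon.1).1
  obtain ⟨y₀, hy₀, hy₀p⟩ := hhit p'
  by_cases hp'S : p' ∈ S
  · have hpp' := h.adj_of_ne hs hp'S h'.ne
    have hx : ∀ y ∈ σ.support, c y = p' → c (σ.symm y) = p := fun y hy hyp =>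
      (hor y hy hyp).resolve_right fun h1 => hpp'.2 (by rw [← h1, ← hyp]; exact hf.adj y hy)
    have hz : ∀ y ∈ σ.support, c y = p' → c (σ y) = v := by
      intro y hy hyp
      have hzp : c (σ y) ≠ p := fun h1 => hpp'.2 (by rw [← h1, ← hyp]; exact hf.adj y hy)
      have hz2 := (hz' y hy hyp).resolve_left hzp
      by_contra hzv
      by_cases hzS : c (σ y) ∈ S
      · exact hskip y hy hyp (by rw [hx y hy hyp]; exact (h.adj_of_ne hs hzS hzp).1)
      · exact (h'.adj_of_ne hs hz2.1 hz2.2).2 (h.adj_of_notMem hs hp'S hzS hzv).1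
    have hpv : ¬ T.Adj p v := by
      have := hskip y₀ hy₀ hy₀p
      rwa [hx y₀ hy₀ hy₀p, hz y₀ hy₀ hy₀p] at this
    have hvS' : v ∈ S' := by
      have := hz' y₀ hy₀ hy₀p
      rw [hz y₀ hy₀ hy₀p] at this
      exact (this.resolve_left h.ne.symm).1
    -- every class other than `v` lies in `S`, since no arc enters the remaining ones
    have hZ : ∀ i, i ∈ S ∨ i = v := by
      by_contra! hcon
      obtain ⟨i₀, h1, h2⟩ := hcon
      obtain ⟨i, hi, j, hj, hij⟩ := hst {i | i ∈ S ∨ i = v} ⟨v, Or.inr rfl⟩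
        ⟨i₀, by rintro (h | h) <;> contradiction⟩
      have hj' : j ∉ S ∧ j ≠ v := not_or.1 hj
      rcases hi with hi | rfl
      · rcases h.eq_or_mem hi hij with h3 | h3
        exacts [hj'.2 h3, hj'.1 h3.1]
      · rcases h'.eq_or_mem hvS' hij with rfl | h3
        · exact hj'.1 h.mem
        · exact (h'.adj_of_ne hs h3.1 h3.2).2 (h.adj_of_notMem hs hp'S hj'.1 hj'.2).1
    refine hσ.isTriangularWith hhit (a := p) (b := p') (d := v)
      (hf.forall_apply_of_mass_eq h'.mass_eq.symm hx) hz ?_ hpp'.2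
      (h'.adj_of_ne hs hvS' hne.symm).2 hpv
    intro w hw hwv
    have hnot : c (σ w) ∉ outNbr T S := fun h1 => by
      have := hf.mem_of_tight h.tight hw h1
      rw [hwv] at this
      exact h.notMem this
    rw [h.out, Set.mem_insert_iff, not_or] at hnot
    by_contra hne
    exact hnot.2 ⟨(hZ _).resolve_right hnot.1, hne⟩
  · have hin : ∀ i ∈ S, T.Adj p' i ∧ ¬ T.Adj i p' := fun i hi => h.adj_of_notMem hs hi hp'S hne
    have hz : ∀ y ∈ σ.support, c y = p' → c (σ y) = p := fun y hy hyp =>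
      (hor y hy hyp).resolve_left fun h1 =>
        (hin p h.mem).2 (by rw [← h1, ← hyp]; exact hpred y hy)
    have hSS' : ∀ i ∈ S, i ≠ p → i ∈ S' := fun i hi hip =>
      ((h'.eq_or_mem h'.mem (hin i hi).1).resolve_left hip).1
    have hx : ∀ y ∈ σ.support, c y = p' → c (σ.symm y) = v := by
      intro y hy hyp
      have hxp : c (σ.symm y) ≠ p := fun h1 =>
        (hin p h.mem).2 (by rw [← h1, ← hyp]; exact hpred y hy)
      by_contra hxv
      by_cases hxS : c (σ.symm y) ∈ S
      · exact hx' y hy hyp (hSS' _ hxS hxp)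
      · exact hskip y hy hyp (by rw [hz y hy hyp]; exact (h.adj_of_notMem hs h.mem hxS hxv).1)
    have hvp : ¬ T.Adj v p := by
      have := hskip y₀ hy₀ hy₀p
      rwa [hx y₀ hy₀ hy₀p, hz y₀ hy₀ hy₀p] at this
    have hvS' : v ∉ S' := by
      have := hx' y₀ hy₀ hy₀p
      rwa [hx y₀ hy₀ hy₀p] at this
    have hv : ∀ i ∈ S', T.Adj v i ∧ ¬ T.Adj i v := fun i hi =>
      h'.adj_of_notMem hs hi hvS' h.ne.symm
    -- `S` is just `{p}`, since no arc leaves the rest of it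
    have hSp : ∀ i ∈ S, i = p := by
      by_contra! hcon
      obtain ⟨i₀, h1, h2⟩ := hcon
      obtain ⟨i, hi, j, hj, hij⟩ := hst (S \ {p}) ⟨i₀, h1, h2⟩ ⟨p, by simp⟩
      rcases h.eq_or_mem hi.1 hij with rfl | h3
      · exact (hv i (hSS' i hi.1 hi.2)).2 hij
      · exact hj h3
    refine hσ.isTriangularWith hhit (a := v) (b := p') (d := p)
      (hf.forall_apply_of_mass_eq (h.mass_eq.symm.trans h'.mass_eq.symm) hx) hz ?_
      (hv p' h'.mem).2 (hin p h.mem).2 hvp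
    intro w hw hwp
    rcases h.eq_or_mem h.mem (hwp ▸ hf.adj w hw) with h1 | h1
    · exact h1
    · exact absurd (hSp _ h1.1) h1.2

end Digraph

/-! ### Blow-ups of semicomplete digraphs that are not triangular -/

namespace Digraph

variable {V ι : Type*} [Fintype V] [DecidableEq V] {T : Digraph ι} {c : V → ι}

/-- A Hamiltonian blow-up of a non-triangular semicomplete digraph, with some class of size at least
two, either stays Hamiltonian after deletion of a suitable vertex of such a class, or has a digon
hub of two classes of equal size. Otherwise a class `v` of maximum size has a tight exchange with
some `p`, and `p`, having the same size, has one with some `p'`; these two exchanges determine `T`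
so far that only the triangle and the digon hub are left. -/
theorem IsCyclePerm.exists_erase_or_isDigonHub [Fintype ι] (hl : T.IsLoopless)
    (hs : T.IsSemicomplete) (hcard : 3 ≤ Fintype.card ι)
    (hntri : ¬ ∃ P : Fin 3 → Set ι, T.IsTriangularWith P) {σ : Perm V}
    (hσ : (T.blowUp c).IsCyclePerm σ) (hhit : ∀ i, ∃ x ∈ σ.support, c x = i) {i₀ : ι}
    (hi₀ : 2 ≤ mass c σ.support {i₀}) :
    (∃ v ∈ σ.support, (∃ w ∈ σ.support, w ≠ v ∧ c w = c v) ∧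
      (T.blowUp c).CyclicOn (σ.support.erase v)) ∨
    ∃ p q, IsDigonHub T p q ∧ mass c σ.support {p} = mass c σ.support {q} := by
  classical
  have hf := hσ.isFactor
  have hst := hσ.isStronglyConnected hhit
  by_contra! hcon
  obtain ⟨hno, hhub⟩ := hcon
  -- `v` is a class of maximum size
  obtain ⟨v, -, hv⟩ := Finset.exists_max_image Finset.univ (fun i => mass c σ.support {i})
    ⟨i₀, Finset.mem_univ _⟩
  replace hv : ∀ i, mass c σ.support {i} ≤ mass c σ.support {v} := fun i => hv i (Finset.mem_univ i)
  have htwin : ∀ u, mass c σ.support {u} = mass c σ.support {v} → ∀ y ∈ σ.support, c y = u →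
      ∃ w ∈ σ.support, w ≠ y ∧ c w = c y := by
    intro u hu y hy hyu
    have h2 : 1 < mass c σ.support {u} := by have := hv i₀; omega
    rw [mass_singleton_eq] at h2
    obtain ⟨w, hw, hwy⟩ := Finset.exists_mem_ne h2 y
    obtain ⟨hw, hwu⟩ := Finset.mem_filter.1 hw
    exact ⟨w, hw, hwy, hwu.trans hyu.symm⟩
  have hex : ∀ u, mass c σ.support {u} = mass c σ.support {v} →
      ∃ S p, IsTightExchange T c σ.support S p u := by
    intro u hu
    obtain ⟨y, hy, rfl⟩ := hhit u
    obtain ⟨w, hw, hwy, hwc⟩ := htwin _ hu y hy rfl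
    obtain ⟨S, h1, h2, h3⟩ := hf.exists_tight hy (by
      rintro ⟨τ, hτ⟩
      refine hno y hy ⟨w, hw, hwy, hwc⟩ ?_
      refine hτ.exists_isCycle hl hs hst ⟨w, by simp only [Finset.mem_erase]; exact ⟨hwy, hw⟩⟩ ?_
      intro i
      obtain ⟨z, hz, rfl⟩ := hhit i
      by_cases hzy : z = y
      · exact ⟨w, by simp only [Finset.mem_erase]; exact ⟨hwy, hw⟩, hzy ▸ hwc⟩
      · exact ⟨z, by simp only [Finset.mem_erase]; exact ⟨hzy, hz⟩, rfl⟩)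
    obtain ⟨p, hp⟩ := exists_isTightExchange hs hhit h1 h2 h3 (fun i => hu ▸ hv i)
    exact ⟨S, p, hp⟩
  obtain ⟨S, p, h⟩ := hex v rfl
  obtain ⟨S', p', h'⟩ := hex p h.mass_eq
  by_cases hpv : p' = v
  · subst hpv
    have h3 : ∀ a b : ι, ∃ z, z ≠ a ∧ z ≠ b := by
      intro a b
      by_contra! hcon
      have hsub : (Finset.univ : Finset ι) ⊆ {a, b} := fun z _ => by
        by_cases hz : z = a
        · simp [hz]
        · simp [hcon z hz]
      have := Finset.card_le_card hsub
      have := Finset.card_le_two (a := a) (b := b)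
      rw [Finset.card_univ] at *
      omega
    rcases h.eq_singleton_or hs hst h' with ⟨rfl, h2⟩ | ⟨rfl, h2⟩
    · exact hhub _ _ (h.isDigonHub hs h' h2 (h3 _ _) hntri) h.mass_eq
    · exact hhub _ _ (h'.isDigonHub hs h h2 (h3 _ _) hntri) h'.mass_eq
  · refine hntri (h.isTriangularWith hs hσ hhit h' hpv fun y hy hyp hskip => ?_)
    have hcard3 : 3 ≤ σ.support.card := by
      refine hcard.trans ?_
      rw [← Finset.card_univ]
      refine (Finset.card_le_card fun i _ => ?_).trans
        (Finset.card_image_le (s := σ.support) (f := c))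
      obtain ⟨x, hx, rfl⟩ := hhit i
      exact Finset.mem_image_of_mem c hx
    obtain ⟨τ, hτ, sτ, -⟩ := hσ.exists_erase (x := σ.symm y) (by rwa [apply_symm_apply]) hcard3
      (by rw [apply_symm_apply]; exact hskip)
    rw [apply_symm_apply] at sτ
    exact hno y hy (htwin p' (h'.mass_eq.trans h.mass_eq) y hy hyp) (sτ ▸ hτ.cyclicOn)

/-- The vertices outside the classes of a digon hub can be deleted one by one from a Hamiltonian
cycle: each maximal run of such vertices is entered from `q`, and `q` dominates whatever follows
its first vertex. -/
theorem IsDigonHub.exists_cyclicOn_of_two_mul_le {p q : ι} (h : IsDigonHub T p q) {k n : ℕ} :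
    ∀ {U : Finset V}, U.card = n → (T.blowUp c).CyclicOn U → mass c U {p} = mass c U {q} →
      0 < mass c U {p} → 2 * mass c U {p} ≤ k → k ≤ U.card →
      ∃ W : Finset V, W.card = k ∧ (T.blowUp c).CyclicOn W := by
  classical
  induction n with
  | zero =>
    intro U hU _ _ _ _ hk
    exact ⟨U, by omega, ‹_›⟩
  | succ n ih =>
    intro U hn hU hpq hpos hk hkU
    rcases hkU.eq_or_lt with rfl | hlt
    · exact ⟨U, rfl, hU⟩
    obtain ⟨σ, hσ, rfl⟩ := cyclicOn_iff.1 hU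
    have hex : ∃ y ∈ σ.support, ¬ (c y = p ∨ c y = q) := by
      by_contra! hcon
      have : mass c σ.support ({p} ∪ {q}) = σ.support.card := by
        unfold mass
        congr 1
        ext x
        simp only [Finset.mem_filter, and_iff_left_iff_imp]
        exact fun hx => hcon x hx
      rw [mass_union (by simpa using h.ne), ← hpq] at this
      omega
    obtain ⟨y, hy, hyn⟩ := hex
    obtain ⟨x, hx, hxp⟩ : ∃ x ∈ σ.support, c x = p := by
      rw [mass_singleton_eq] at hpos
      obtain ⟨x, hx⟩ := Finset.card_pos.1 hpos
      exact ⟨x, (Finset.mem_filter.1 hx).1, (Finset.mem_filter.1 hx).2⟩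
    obtain ⟨z, hz, hzP, hzn⟩ := hσ.exists_and_not_apply (P := fun x => c x = p ∨ c x = q) hx
      (Or.inl hxp) hy hyn
    rw [not_or] at hzn
    have hσz : σ z ∈ σ.support := apply_mem_support.2 hz
    have hzadj : T.Adj (c z) (c (σ z)) := hσ.adj z hz
    have hzadj' : T.Adj (c (σ z)) (c (σ (σ z))) := hσ.adj _ hσz
    have hzq : c z = q := hzP.resolve_left fun h1 => h.not_adj_right _ hzn.1 hzn.2 (h1 ▸ hzadj)
    obtain ⟨τ, hτ, sτ, -⟩ := hσ.exists_erase hσz (by omega) (by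
      change T.Adj (c z) (c (σ (σ z)))
      rw [hzq]
      by_cases h1 : c (σ (σ z)) = p
      · rw [h1]; exact h.adj'
      by_cases h2 : c (σ (σ z)) = q
      · exact absurd (h2 ▸ hzadj') (h.not_adj_left _ hzn.1 hzn.2)
      · exact h.adj_left _ h1 h2)
    have hc := Finset.card_erase_of_mem hσz
    refine ih (U := σ.support.erase (σ z)) (by omega) (sτ ▸ hτ.cyclicOn) ?_ ?_ ?_ (by omega)
    · rw [mass_erase_of_ne hzn.1, mass_erase_of_ne hzn.2, hpq]
    · rwa [mass_erase_of_ne hzn.1]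
    · rwa [mass_erase_of_ne hzn.1]

/-- A Hamiltonian blow-up with a digon hub of two equal classes is pancyclic: long cycles arise by
deletion, short ones alternate between the two classes and use at most one further vertex. -/
theorem IsDigonHub.exists_cyclicOn {p q : ι} (h : IsDigonHub T p q) {U : Finset V}
    (hU : (T.blowUp c).CyclicOn U) (hpq : mass c U {p} = mass c U {q}) {a z : V} (ha : a ∈ U)
    (hap : c a = p) (hzp : c z ≠ p) (hzq : c z ≠ q) {k : ℕ} (hk : 3 ≤ k)
    (hkU : k ≤ U.card) : ∃ W : Finset V, W.card = k ∧ (T.blowUp c).CyclicOn W := by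
  classical
  rcases le_or_gt (2 * mass c U {p}) k with hle | hlt
  · exact h.exists_cyclicOn_of_two_mul_le rfl hU hpq (mass_pos ha hap) hle hkU
  have hpq' := hpq
  rw [mass_singleton_eq, mass_singleton_eq] at hpq'
  rw [mass_singleton_eq] at hlt
  have hdis : Disjoint (U.filter fun x => c x = p) (U.filter fun x => c x = q) := by
    rw [Finset.disjoint_filter]
    rintro x - h1 h2
    exact h.ne (h1.symm.trans h2)
  have hadj : ∀ a ∈ U.filter fun x => c x = p, ∀ b ∈ U.filter fun x => c x = q,
      (T.blowUp c).Adj a b ∧ (T.blowUp c).Adj b a := by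
    intro a ha b hb
    have h1 := (Finset.mem_filter.1 ha).2
    have h2 := (Finset.mem_filter.1 hb).2
    change T.Adj (c a) (c b) ∧ T.Adj (c b) (c a)
    rw [h1, h2]
    exact ⟨h.adj, h.adj'⟩
  obtain ⟨j, rfl | rfl⟩ : ∃ j, k = 2 * j ∨ k = 2 * j + 1 := ⟨k / 2, by omega⟩
  · exact exists_cyclicOn_even hdis hadj (by omega) (by omega) (by omega)
  · refine exists_cyclicOn_odd (a₀ := a) (z := z) hdis hadj (by simp [ha, hap]) (by simp [hzp])
      (by simp [hzq]) (fun b hb => ?_) ?_ (by omega) (by omega) (by omega)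
    · change T.Adj (c b) (c z)
      rw [(Finset.mem_filter.1 hb).2]
      exact h.adj_left _ hzp hzq
    · change T.Adj (c z) (c a)
      rw [hap]
      exact h.adj_right _ hzp hzq

/-- Hamiltonian blow-ups of non-triangular semicomplete digraphs are pancyclic. -/
theorem hasCycleOfLength_blowUp [Fintype ι] (hl : T.IsLoopless)
    (hs : T.IsSemicomplete) (hcard : 3 ≤ Fintype.card ι)
    (hntri : ¬ ∃ P : Fin 3 → Set ι, T.IsTriangularWith P) {k : ℕ} (hk : 3 ≤ k) {n : ℕ} :
    ∀ {U : Finset V}, U.card = n → (T.blowUp c).CyclicOn U → (∀ i, ∃ x ∈ U, c x = i) →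
      k ≤ U.card → (T.blowUp c).HasCycleOfLength k := by
  classical
  induction n with
  | zero => intro U h1 _ _ h2; omega
  | succ n ih =>
    intro U hn hU hhit hkU
    rcases hkU.eq_or_lt with rfl | hlt
    · exact hasCycleOfLength_iff.2 ⟨U, rfl, hU⟩
    obtain ⟨σ, hσ, rfl⟩ := cyclicOn_iff.1 hU
    rcases le_or_gt k (Fintype.card ι) with hkc | hkc
    · -- a cycle of `T` is lifted along a choice of representatives
      choose f hf using hhit
      refine (hasCycleOfLength_iff.2 ((hσ.isStronglyConnected
        fun i => ⟨f i, hf i⟩).exists_cyclicOn hl hs hk hkc)).map (f := f) (fun i j hij => ?_)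
        fun i j hij => ?_
      · rw [← (hf i).2, ← (hf j).2, hij]
      · change T.Adj (c (f i)) (c (f j))
        rwa [(hf i).2, (hf j).2]
    · obtain ⟨x, hx, y, hy, hxy, hcxy⟩ := Finset.exists_ne_map_eq_of_card_lt_of_maps_to
        (s := σ.support) (t := Finset.univ) (f := c) (by rw [Finset.card_univ]; omega)
        fun _ _ => Finset.mem_coe.2 (Finset.mem_univ _)
      have h2 : 2 ≤ mass c σ.support {c x} := by
        rw [mass_singleton_eq]
        exact Finset.one_lt_card.2 ⟨x, by simpa using hx, y, by
          simpa [hcxy] using hy, hxy⟩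
      rcases hσ.exists_erase_or_isDigonHub hl hs hcard hntri hhit h2 with
        ⟨v, hv, ⟨w, hw, hwv, hwc⟩, hW⟩ | ⟨p, q, hpq, hm⟩
      · have hc := Finset.card_erase_of_mem hv
        refine ih (by omega) hW (fun i => ?_) (by omega)
        obtain ⟨z, hz, rfl⟩ := hhit i
        by_cases hzv : z = v
        · exact ⟨w, Finset.mem_erase.2 ⟨hwv, hw⟩, hzv ▸ hwc⟩
        · exact ⟨z, Finset.mem_erase.2 ⟨hzv, hz⟩, rfl⟩
      · obtain ⟨a, ha, hap⟩ := hhit p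
        obtain ⟨i, hip, hiq⟩ : ∃ i, i ≠ p ∧ i ≠ q := by
          by_contra! hcon
          have hsub : (Finset.univ : Finset ι) ⊆ {p, q} := fun z _ => by
            by_cases hz : z = p
            · simp [hz]
            · simp [hcon z hz]
          have h3 := Finset.card_le_card hsub
          have h4 := Finset.card_le_two (a := p) (b := q)
          rw [Finset.card_univ] at h3
          omega
        obtain ⟨z, -, rfl⟩ := hhit i
        exact hasCycleOfLength_iff.2 (hpq.exists_cyclicOn hU hm ha hap hip hiq hk hkU)

/-! ### Contracting the arcs inside the classes -/

variable {D : Digraph V}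

/-- Arcs of a cycle inside the classes can be contracted one after the other, until a cycle of the
blow-up remains: the first vertex of a path inside a class can be skipped. -/
theorem IsCompositionOver.exists_contraction (hD : D.IsCompositionOver T c) {n : ℕ} :
    ∀ {U : Finset V}, U.card = n → D.CyclicOn U → (∃ x ∈ U, ∃ y ∈ U, c x ≠ c y) →
    ∃ W ⊆ U, (T.blowUp c).CyclicOn W ∧ (∀ x ∈ U, ∃ y ∈ W, c y = c x) ∧
      (∀ x ∈ U, x ∉ W → ∃ y, c y = c x ∧ D.Adj x y) ∧
      ∀ k, W.card ≤ k → k ≤ U.card → D.HasCycleOfLength k := by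
  induction n with
  | zero =>
    rintro U hn - ⟨x, hx, -⟩
    rw [Finset.card_eq_zero.1 hn] at hx
    simp at hx
  | succ n ih =>
    intro U hn hU hxy
    obtain ⟨σ, hσ, rfl⟩ := cyclicOn_iff.1 hU
    by_cases hint : ∃ z ∈ σ.support, c (σ z) = c z
    · obtain ⟨z, hz, hzc⟩ := hint
      have hex : ∃ y ∈ σ.support, c (σ y) ≠ c y := by
        by_contra! hcon
        obtain ⟨x, hx, y, hy, hne⟩ := hxy
        exact hne (hσ.forall_of_closed (P := fun y => c x = c y) hx rfl
          (fun w hw h => h.trans (hcon w hw).symm) y hy)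
      obtain ⟨y, hy, hyc⟩ := hex
      obtain ⟨x, hx, hxc, hxc'⟩ := hσ.exists_and_not_apply (P := fun x => c (σ x) ≠ c x) hy hyc hz
        (not_not.2 hzc)
      rw [not_not] at hxc'
      have hx1 : σ x ∈ σ.support := apply_mem_support.2 hx
      have hx2 : σ (σ x) ∈ σ.support := apply_mem_support.2 hx1
      have hne1 : σ (σ x) ≠ σ x := mem_support.1 hx1
      have hadj : D.Adj x (σ (σ x)) := by
        have := (hD _ _ hxc.symm).1 (hσ.adj x hx)
        rw [← hxc'] at this
        exact (hD _ _ (by rw [hxc']; exact hxc.symm)).2 this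
      have h3 : 3 ≤ σ.support.card := by
        rw [← Finset.card_eq_three.2 ⟨x, σ x, σ (σ x), by rintro h; exact hxc (by rw [← h]),
          by rintro h; exact hxc (by rw [← hxc', ← h]), hne1.symm, rfl⟩]
        exact Finset.card_le_card (by simp [Finset.insert_subset_iff, hx, hx1, hx2])
      obtain ⟨τ, hτ, sτ, -⟩ := hσ.exists_erase hx1 h3 hadj
      have hc := Finset.card_erase_of_mem hx1
      obtain ⟨W, hWU, hW, hhit, hind, hlen⟩ := ih (U := σ.support.erase (σ x)) (by omega)
        (sτ ▸ hτ.cyclicOn) ⟨x, by simp only [Finset.mem_erase]; exact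
          ⟨fun h => hxc (by rw [← h]), hx⟩, σ (σ x), by
            simp only [Finset.mem_erase]; exact ⟨hne1, hx2⟩, by rw [hxc']; exact hxc.symm⟩
      refine ⟨W, hWU.trans (Finset.erase_subset _ _), hW, fun w hw => ?_, fun w hw hwW => ?_,
        fun k hk hkU => ?_⟩
      · by_cases hwx : w = σ x
        · obtain ⟨y, hy, hyc⟩ := hhit _ (Finset.mem_erase.2 ⟨hne1, hx2⟩)
          exact ⟨y, hy, by rw [hyc, hxc', hwx]⟩
        · exact hhit w (Finset.mem_erase.2 ⟨hwx, hw⟩)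
      · by_cases hwx : w = σ x
        · rw [hwx]; exact ⟨_, hxc', hσ.adj _ hx1⟩
        · exact hind w (Finset.mem_erase.2 ⟨hwx, hw⟩) hwW
      · rcases hkU.eq_or_lt with rfl | hlt
        · exact hasCycleOfLength_iff.2 ⟨_, rfl, hU⟩
        · exact hlen k hk (by omega)
    · push Not at hint
      refine ⟨_, subset_rfl, IsCyclePerm.cyclicOn ⟨hσ.isCycle, fun x hx => ?_⟩,
        fun x hx => ⟨x, hx, rfl⟩, fun x hx hx' => absurd hx hx', fun k hk hkU => ?_⟩
      · exact (hD _ _ (hint x hx).symm).1 (hσ.adj x hx)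
      · exact hasCycleOfLength_iff.2 ⟨_, le_antisymm hk hkU, hU⟩

/-- A Hamiltonian composition of a non-triangular semicomplete digraph with at least three vertices
is pancyclic. -/
theorem IsCompositionOver.hasCycleOfLength [Fintype ι] (hD : D.IsCompositionOver T c)
    (hl : T.IsLoopless) (hs : T.IsSemicomplete) (hcard : 3 ≤ Fintype.card ι)
    (hsurj : Function.Surjective c) (hntri : ¬ ∃ P : Fin 3 → Set ι, T.IsTriangularWith P)
    (hham : D.CyclicOn Finset.univ) {k : ℕ} (hk : 3 ≤ k) (hkn : k ≤ Fintype.card V) :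
    D.HasCycleOfLength k := by
  have : Nontrivial ι := Fintype.one_lt_card_iff_nontrivial.1 (by omega)
  obtain ⟨i, j, hij⟩ := exists_pair_ne ι
  obtain ⟨x, rfl⟩ := hsurj i
  obtain ⟨y, rfl⟩ := hsurj j
  obtain ⟨W, -, hW, hhit, -, hlen⟩ := hD.exists_contraction rfl hham
    ⟨x, Finset.mem_univ _, y, Finset.mem_univ _, hij⟩
  rcases le_or_gt k W.card with h | h
  · refine (hasCycleOfLength_blowUp hl hs hcard hntri hk rfl hW (fun i => ?_) h).map
      Function.injective_id (hD.adj_of_blowUp hl)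
    obtain ⟨x, rfl⟩ := hsurj i
    exact hhit x (Finset.mem_univ _)
  · exact hlen k h.le (by rwa [Finset.card_univ])

end Digraph

/-! ### Compositions of two digraphs -/

namespace Digraph

variable {V ι : Type*} [Fintype V] [DecidableEq V] {T : Digraph ι} {c : V → ι} {D : Digraph V}

/-- A Hamiltonian composition of two digraphs, one of which contains an arc `x → y`, is pancyclic:
the cycles alternate between the two classes, apart from the arc `x → y` for odd lengths. -/
theorem IsCompositionOver.hasCycleOfLength_of_two (hD : D.IsCompositionOver T c)
    (hlD : D.IsLoopless) (hl : T.IsLoopless) {p q : ι} (hpq : p ≠ q) (hcov : ∀ i, i = p ∨ i = q)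
    (hsurj : Function.Surjective c) (hham : D.CyclicOn Finset.univ) {x y : V} (hx : c x = p)
    (hy : c y = p) (hxy : D.Adj x y) {k : ℕ} (hk : 3 ≤ k) (hkn : k ≤ Fintype.card V) :
    D.HasCycleOfLength k := by
  classical
  obtain ⟨b₀, hb₀⟩ := hsurj q
  obtain ⟨W, -, hW, hhit, -, hlen⟩ := hD.exists_contraction rfl hham
    ⟨x, Finset.mem_univ _, b₀, Finset.mem_univ _, by rw [hx, hb₀]; exact hpq⟩
  rcases le_or_gt W.card k with hle | hlt
  · exact hlen k hle (by rwa [Finset.card_univ])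
  obtain ⟨σ, hσ, rfl⟩ := cyclicOn_iff.1 hW
  have hf := hσ.isFactor
  have hnext : ∀ i j, (∀ l, l = i ∨ l = j) → outNbr T {i} ⊆ {j} := by
    rintro i j hij l ⟨_, rfl, hl'⟩
    exact (hij l).resolve_left (by rintro rfl; exact hl _ hl')
  have hmass : mass c σ.support {p} = mass c σ.support {q} :=
    le_antisymm ((hf.mass_le _).trans (mass_mono (hnext p q hcov)))
      ((hf.mass_le _).trans (mass_mono (hnext q p fun l => (hcov l).symm)))
  have hcard : mass c σ.support {p} + mass c σ.support {q} = σ.support.card := by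
    rw [← mass_union (by simpa using hpq)]
    unfold mass
    congr 1
    ext x
    simp only [Finset.mem_filter, and_iff_left_iff_imp]
    exact fun _ => hcov _
  have hTadj : ∀ i j, (∀ l, l = i ∨ l = j) → T.Adj i j := by
    intro i j hij
    obtain ⟨z, rfl⟩ := hsurj i
    obtain ⟨w, hw, hwz⟩ := hhit z (Finset.mem_univ _)
    have := hσ.adj w hw
    change T.Adj (c w) (c (σ w)) at this
    rw [hwz] at this
    rwa [(hij (c (σ w))).resolve_left (fun h => hl _ (h ▸ this))] at this
  have hp : mass c σ.support {p} ≤ (Finset.univ.filter fun x => c x = p).card := by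
    rw [mass_singleton_eq]
    exact Finset.card_le_card (Finset.filter_subset_filter _ (Finset.subset_univ _))
  have hq : mass c σ.support {q} ≤ (Finset.univ.filter fun x => c x = q).card := by
    rw [mass_singleton_eq]
    exact Finset.card_le_card (Finset.filter_subset_filter _ (Finset.subset_univ _))
  have hdis : Disjoint (Finset.univ.filter fun x => c x = p)
      (Finset.univ.filter fun x => c x = q) := by
    rw [Finset.disjoint_filter]
    rintro x - h1 h2
    exact hpq (h1.symm.trans h2)
  have hadj : ∀ a, c a = p → ∀ b, c b = q → D.Adj a b ∧ D.Adj b a := by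
    intro a ha b hb
    constructor
    · rw [hD a b (by rw [ha, hb]; exact hpq), ha, hb]
      exact hTadj p q hcov
    · rw [hD b a (by rw [ha, hb]; exact hpq.symm), ha, hb]
      exact hTadj q p fun l => (hcov l).symm
  have hadj' : ∀ a ∈ Finset.univ.filter (fun x => c x = p),
      ∀ b ∈ Finset.univ.filter (fun x => c x = q), D.Adj a b ∧ D.Adj b a := fun a ha b hb =>
    hadj a (by simpa using ha) b (by simpa using hb)
  rw [hasCycleOfLength_iff]
  obtain ⟨j, rfl | rfl⟩ : ∃ j, k = 2 * j ∨ k = 2 * j + 1 := ⟨k / 2, by omega⟩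
  · exact exists_cyclicOn_even hdis hadj' (by omega) (by omega) (by omega)
  · have hyx : y ≠ x := by rintro rfl; exact hlD _ hxy
    have hxA : x ∈ Finset.univ.filter fun x => c x = p := by simp [hx]
    have he := Finset.card_erase_of_mem hxA
    exact exists_cyclicOn_odd (a₀ := y) (z := x)
      (A := (Finset.univ.filter fun x => c x = p).erase x)
      (hdis.mono_left (Finset.erase_subset _ _))
      (fun a ha b hb => hadj' a (Finset.mem_of_mem_erase ha) b hb) (by simp [hyx, hy])
      (Finset.notMem_erase _ _) (by simp [hx, hpq])
      (fun b hb => (hadj x hx b (by simpa using hb)).2) hxy (by omega) (by omega) (by omega)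

end Digraph

/-! ### Triangular digraphs -/

namespace Digraph

/-- The directed triangle `0 → 1 → 2 → 0`. -/
def triangle : Digraph (Fin 3) where
  Adj i j := j = i + 1

theorem outNbr_triangle (i : Fin 3) : outNbr triangle {i} = {i + 1} := by
  ext j
  constructor
  · rintro ⟨_, rfl, h⟩; exact h
  · intro h; exact ⟨i, rfl, h⟩

/-- A triangular partition is the same as a map to the directed triangle. -/
theorem IsTriangularWith.exists_class {V : Type*} {D : Digraph V} {P : Fin 3 → Set V}
    (h : D.IsTriangularWith P) :
    ∃ c : V → Fin 3, (∀ i, P i = {x | c x = i}) ∧ D.IsCompositionOver triangle c ∧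
      Function.Surjective c := by
  have hex : ∀ x, ∃ i, x ∈ P i := fun x => by
    have : x ∈ ⋃ i, P i := h.cover ▸ Set.mem_univ x
    simpa using this
  choose c hc using hex
  have hP : ∀ x i, x ∈ P i → c x = i := fun x i hx => by
    by_contra hne
    exact Set.disjoint_left.1 (h.disjoint _ _ hne) (hc x) hx
  have hdom : ∀ i : Fin 3, D.StrictlyDominates (P i) (P (i + 1)) := by
    intro i
    fin_cases i
    exacts [h.dom01, h.dom12, h.dom20]
  refine ⟨c, fun i => Set.ext fun x => ⟨hP x i, fun hx => by
    have : c x = i := hx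
    exact this ▸ hc x⟩, fun x y hxy => ?_, fun i => ?_⟩
  · change D.Adj x y ↔ c y = c x + 1
    have key : ∀ i j : Fin 3, i ≠ j → j = i + 1 ∨ i = j + 1 ∧ j ≠ i + 1 := by decide
    rcases key _ _ hxy with h1 | h1
    · exact iff_of_true (hdom _ x (hc x) y (h1 ▸ hc y)).1 h1
    · exact iff_of_false (hdom _ y (hc y) x (h1.1 ▸ hc x)).2 h1.2
  · obtain ⟨x, hx⟩ := h.nonempty i
    exact ⟨x, hP x i hx⟩

variable {V : Type*} [Fintype V] [DecidableEq V] {D : Digraph V} {c : V → Fin 3}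

/-- In a composition over the triangle, a cycle using an arc between two classes can be extended
by going around the triangle `r` more times, as long as each class has `r` unused vertices. -/
theorem IsCyclePerm.exists_rounds (hD : D.IsCompositionOver triangle c) {r : ℕ} :
    ∀ {τ : Perm V}, D.IsCyclePerm τ → ∀ x ∈ τ.support, c (τ x) = c x + 1 →
      (∀ i, (τ.support.filter fun y => c y = i).card + r ≤
        (Finset.univ.filter fun y => c y = i).card) →
      ∃ W : Finset V, W.card = τ.support.card + 3 * r ∧ D.CyclicOn W := by
  induction r with
  | zero => intro τ h x _ _ _; exact ⟨_, rfl, h.cyclicOn⟩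
  | succ r ih =>
    intro τ h x hx hcx hr
    have hex : ∀ i, ∃ y, c y = i ∧ y ∉ τ.support := by
      intro i
      by_contra! hcon
      have := Finset.card_le_card (s := Finset.univ.filter fun y => c y = i)
        (t := τ.support.filter fun y => c y = i) fun y hy => by
          rw [Finset.mem_filter] at hy ⊢
          exact ⟨hcon y hy.2, hy.2⟩
      have := hr i
      omega
    have key : ∀ i : Fin 3, i ≠ i + 1 ∧ i ≠ i + 1 + 1 ∧ i + 1 + 1 + 1 = i := by decide
    obtain ⟨k1, k2, k3⟩ := key (c x)
    obtain ⟨k1', -, -⟩ := key (c x + 1)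
    obtain ⟨u, hu, hus⟩ := hex (c x + 1)
    obtain ⟨v, hv, hvs⟩ := hex (c x + 1 + 1)
    obtain ⟨w, hw, hws⟩ := hex (c x)
    have hadj : ∀ a b, c b = c a + 1 → D.Adj a b := fun a b hab =>
      (hD a b (by rw [hab]; exact (key _).1)).2 hab
    have huv : u ≠ v := by rintro rfl; exact k1' (hu.symm.trans hv)
    have hvw : v ≠ w := by rintro rfl; exact k2 (hw.symm.trans hv)
    have huw : u ≠ w := by rintro rfl; exact k1 (hw.symm.trans hu)
    obtain ⟨τ', h', s', e'⟩ := h.exists_insert_three hus hvs hws huv hvw huw hx (hadj _ _ hu)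
      (hadj _ _ (by rw [hu, hv])) (hadj _ _ (by rw [hv, hw, k3])) (hadj _ _ (by rw [hw, hcx]))
    have hc' : τ'.support.card = τ.support.card + 3 := by
      rw [s', Finset.card_insert_of_notMem, Finset.card_insert_of_notMem,
        Finset.card_insert_of_notMem hus]
      · simp [huv.symm, hvs]
      · simp [hvw.symm, huw.symm, hws]
    obtain ⟨W, hW, hcyc⟩ := ih h' x (by simp [s', hx]) (by rw [e', hu]) (fun i => by
      have h1 := hr i
      have h2 : (τ'.support.filter fun y => c y = i).card ≤
          (τ.support.filter fun y => c y = i).card + 1 := by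
        have key3 : ∀ j i : Fin 3, i = j ∨ i = j + 1 ∨ i = j + 1 + 1 := by decide
        rw [s', Finset.filter_insert, Finset.filter_insert, Finset.filter_insert, hu, hv, hw]
        rcases key3 (c x) i with rfl | rfl | rfl
        · rw [if_pos rfl, if_neg k2.symm, if_neg k1.symm]
          exact Finset.card_insert_le _ _
        · rw [if_neg k1, if_neg k1'.symm, if_pos rfl]
          exact Finset.card_insert_le _ _
        · rw [if_neg k2, if_pos rfl, if_neg k1']
          exact Finset.card_insert_le _ _
      omega)
    exact ⟨W, by omega, hcyc⟩

end Digraph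

namespace Digraph

variable {V : Type*} {D : Digraph V} {c : V → Fin 3}

theorem card_filter_insert_le {α : Type*} [DecidableEq α] (s : Finset α) (a : α) (p : α → Prop)
    [DecidablePred p] :
    ((insert a s).filter p).card ≤ (if p a then 1 else 0) + (s.filter p).card := by
  rw [Finset.filter_insert]
  split_ifs
  · rw [add_comm]; exact Finset.card_insert_le _ _
  · omega

theorem fin_three_add (i : Fin 3) : i ≠ i + 1 ∧ i ≠ i + 1 + 1 ∧ i + 1 ≠ i + 1 + 1 ∧
    i + 1 + 1 + 1 = i := by
  revert i; decide

theorem fin_three_cases (i j : Fin 3) : j = i ∨ j = i + 1 ∨ j = i + 1 + 1 := by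
  revert i j; decide

theorem IsCompositionOver.adj_of_eq_add_one (hD : D.IsCompositionOver triangle c) {a b : V}
    (hab : c b = c a + 1) : D.Adj a b :=
  (hD a b (by rw [hab]; exact (fin_three_add _).1)).2 hab

theorem IsCompositionOver.eq_or_eq_add_one (hD : D.IsCompositionOver triangle c) {a b : V}
    (hab : D.Adj a b) : c b = c a ∨ c b = c a + 1 := by
  by_cases h : c a = c b
  · exact Or.inl h.symm
  · exact Or.inr ((hD a b h).1 hab)

theorem sum_card_filter (c : V → Fin 3) (W : Finset V) (i : Fin 3) :
    (W.filter fun y => c y = i).card + (W.filter fun y => c y = i + 1).card +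
      (W.filter fun y => c y = i + 1 + 1).card = W.card := by
  have := Finset.card_eq_sum_card_fiberwise (f := c) (s := W) (t := Finset.univ)
    fun _ _ => Finset.mem_coe.2 (Finset.mem_univ _)
  rw [Fin.sum_univ_three] at this
  fin_cases i <;> simp <;> omega

variable [Fintype V] [DecidableEq V]

/-- A choice of one vertex in each class gives a directed triangle. -/
theorem IsCompositionOver.exists_triangle (hD : D.IsCompositionOver triangle c) {x y z : V}
    (hy : c y = c x + 1) (hz : c z = c x + 1 + 1) :
    ∃ τ : Perm V, D.IsCyclePerm τ ∧ τ.support = {x, y, z} ∧ τ x = y ∧ τ y = z ∧ τ z = x := by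
  obtain ⟨k1, k2, k3, k4⟩ := fin_three_add (c x)
  refine exists_isCyclePerm_triangle ?_ ?_ ?_ (hD.adj_of_eq_add_one hy)
    (hD.adj_of_eq_add_one (by rw [hy, hz])) (hD.adj_of_eq_add_one (by rw [hz, k4]))
  · rintro rfl; exact k1 hy
  · rintro rfl; exact k3 (hy.symm.trans hz)
  · rintro rfl; exact k2 hz

theorem IsCompositionOver.exists_cyclicOn_three_mul (hD : D.IsCompositionOver triangle c)
    (hsurj : Function.Surjective c) {j : ℕ} (hj : 1 ≤ j)
    (h : ∀ i, j ≤ (Finset.univ.filter fun y => c y = i).card) :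
    ∃ W : Finset V, W.card = 3 * j ∧ D.CyclicOn W := by
  obtain ⟨x, hx⟩ := hsurj 0
  obtain ⟨y, hy⟩ := hsurj (c x + 1)
  obtain ⟨z, hz⟩ := hsurj (c x + 1 + 1)
  obtain ⟨k1, k2, k3, k4⟩ := fin_three_add (c x)
  obtain ⟨τ, hτ, sτ, e1, e2, e3⟩ := hD.exists_triangle hy hz
  obtain ⟨W, hW, hcyc⟩ := IsCyclePerm.exists_rounds hD (r := j - 1) hτ x (by simp [sτ])
    (by rw [e1, hy]) fun i => by
      have h1 := h i
      have h2 := card_filter_insert_le {y, z} x fun w => c w = i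
      have h3 := card_filter_insert_le {z} y fun w => c w = i
      have h4 := card_filter_insert_le ∅ z fun w => c w = i
      rw [← sτ] at h2
      simp only [Finset.filter_empty, Finset.card_empty, hy, hz, insert_empty_eq] at h2 h3 h4
      rcases fin_three_cases (c x) i with rfl | rfl | rfl
      · simp only [if_pos, if_neg k1.symm, if_neg k2.symm] at h2 h3 h4; omega
      · simp only [if_pos, if_neg k1, if_neg k3.symm] at h2 h3 h4; omega
      · simp only [if_pos, if_neg k2, if_neg k3] at h2 h3 h4; omega
  refine ⟨W, ?_, hcyc⟩
  rw [hW, sτ, Finset.card_eq_three.2 ⟨x, y, z, ?_, ?_, ?_, rfl⟩]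
  · omega
  · rintro rfl; exact k1 hy
  · rintro rfl; exact k2 hz
  · rintro rfl; exact k3 (hy.symm.trans hz)

/-- An arc inside a class lengthens a triangle by one vertex. -/
theorem IsCompositionOver.exists_cyclicOn_three_mul_add_one (hD : D.IsCompositionOver triangle c)
    (hlD : D.IsLoopless) (hsurj : Function.Surjective c) {j : ℕ} (hj : 1 ≤ j)
    (h : ∀ i, j + 1 ≤ (Finset.univ.filter fun y => c y = i).card) {x x' : V} (hx : c x' = c x)
    (hxx : D.Adj x' x) : ∃ W : Finset V, W.card = 3 * j + 1 ∧ D.CyclicOn W := by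
  obtain ⟨y, hy⟩ := hsurj (c x + 1)
  obtain ⟨z, hz⟩ := hsurj (c x + 1 + 1)
  obtain ⟨k1, k2, k3, k4⟩ := fin_three_add (c x)
  obtain ⟨τ, hτ, sτ, e1, e2, e3⟩ := hD.exists_triangle hy hz
  have n1 : x' ≠ x := by rintro rfl; exact hlD _ hxx
  have n2 : x' ≠ y := by rintro rfl; exact k1 (hx.symm.trans hy)
  have n3 : x' ≠ z := by rintro rfl; exact k2 (hx.symm.trans hz)
  have n4 : x ≠ y := by rintro rfl; exact k1 hy
  have n5 : x ≠ z := by rintro rfl; exact k2 hz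
  have n6 : y ≠ z := by rintro rfl; exact k3 (hy.symm.trans hz)
  obtain ⟨τ', hτ', s', -, -, f'⟩ := hτ.exists_insert (v := x') (x := z)
    (by simp [sτ, n1, n2, n3]) (by simp [sτ]) (hD.adj_of_eq_add_one (by rw [hz, k4, hx]))
    (by rwa [e3])
  rw [sτ] at s'
  obtain ⟨W, hW, hcyc⟩ := IsCyclePerm.exists_rounds hD (r := j - 1) hτ' x (by simp [s'])
    (by rw [f' x n5 n1.symm, e1, hy]) fun i => by
      have h1 := h i
      have h0 := card_filter_insert_le {x, y, z} x' fun w => c w = i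
      have h2 := card_filter_insert_le {y, z} x fun w => c w = i
      have h3 := card_filter_insert_le {z} y fun w => c w = i
      have h4 := card_filter_insert_le ∅ z fun w => c w = i
      rw [← s'] at h0
      simp only [Finset.filter_empty, Finset.card_empty, hx, hy, hz, insert_empty_eq] at h0 h2 h3 h4
      rcases fin_three_cases (c x) i with rfl | rfl | rfl
      · simp only [if_pos, if_neg k1.symm, if_neg k2.symm] at h0 h2 h3 h4; omega
      · simp only [if_pos, if_neg k1, if_neg k3.symm] at h0 h2 h3 h4; omega
      · simp only [if_pos, if_neg k2, if_neg k3] at h0 h2 h3 h4; omega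
  refine ⟨W, ?_, hcyc⟩
  rw [hW, s', Finset.card_insert_of_notMem (by simp [n1, n2, n3]),
    Finset.card_eq_three.2 ⟨x, y, z, n4, n5, n6, rfl⟩]
  omega

/-- Arcs inside two different classes lengthen a triangle by two vertices. -/
theorem IsCompositionOver.exists_cyclicOn_three_mul_add_two (hD : D.IsCompositionOver triangle c)
    (hlD : D.IsLoopless) (hsurj : Function.Surjective c) {j : ℕ} (hj : 1 ≤ j)
    (h : ∀ i, j + 1 ≤ (Finset.univ.filter fun y => c y = i).card) {x x' y y' : V} (hx : c x' = c x)
    (hxx : D.Adj x' x) (hy : c y = c x + 1) (hy' : c y' = c y) (hyy : D.Adj y y') :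
    ∃ W : Finset V, W.card = 3 * j + 2 ∧ D.CyclicOn W := by
  obtain ⟨z, hz⟩ := hsurj (c x + 1 + 1)
  obtain ⟨k1, k2, k3, k4⟩ := fin_three_add (c x)
  obtain ⟨τ, hτ, sτ, e1, e2, e3⟩ := hD.exists_triangle hy hz
  have hy'' := hy'.trans hy
  have n1 : x' ≠ x := by rintro rfl; exact hlD _ hxx
  have n2 : x' ≠ y := by rintro rfl; exact k1 (hx.symm.trans hy)
  have n3 : x' ≠ z := by rintro rfl; exact k2 (hx.symm.trans hz)
  have n4 : x ≠ y := by rintro rfl; exact k1 hy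
  have n5 : x ≠ z := by rintro rfl; exact k2 hz
  have n6 : y ≠ z := by rintro rfl; exact k3 (hy.symm.trans hz)
  have n7 : y' ≠ x := by rintro rfl; exact k1 hy''
  have n8 : y' ≠ y := by rintro rfl; exact hlD _ hyy
  have n9 : y' ≠ z := by rintro rfl; exact k3 (hy''.symm.trans hz)
  have n10 : y' ≠ x' := by rintro rfl; exact k1 (hx.symm.trans hy'')
  obtain ⟨τ₁, h1, s1, -, -, f1⟩ := hτ.exists_insert (v := x') (x := z)
    (by simp [sτ, n1, n2, n3]) (by simp [sτ]) (hD.adj_of_eq_add_one (by rw [hz, k4, hx]))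
    (by rwa [e3])
  rw [sτ] at s1
  obtain ⟨τ₂, h2, s2, -, -, f2⟩ := h1.exists_insert (v := y') (x := y)
    (by simp [s1, n7, n8, n9, n10]) (by simp [s1]) hyy
    (by rw [f1 y n6 n2.symm, e2]; exact hD.adj_of_eq_add_one (by rw [hz, hy'']))
  rw [s1] at s2
  obtain ⟨W, hW, hcyc⟩ := IsCyclePerm.exists_rounds hD (r := j - 1) h2 x (by simp [s2])
    (by rw [f2 x n4 n7.symm, f1 x n5 n1.symm, e1, hy]) fun i => by
      have h1 := h i
      have g0 := card_filter_insert_le {x', x, y, z} y' fun w => c w = i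
      have h0 := card_filter_insert_le {x, y, z} x' fun w => c w = i
      have h2 := card_filter_insert_le {y, z} x fun w => c w = i
      have h3 := card_filter_insert_le {z} y fun w => c w = i
      have h4 := card_filter_insert_le ∅ z fun w => c w = i
      rw [← s2] at g0
      simp only [Finset.filter_empty, Finset.card_empty, hx, hy, hz, hy'', insert_empty_eq]
        at g0 h0 h2 h3 h4
      rcases fin_three_cases (c x) i with rfl | rfl | rfl
      · simp only [if_pos, if_neg k1.symm, if_neg k2.symm] at g0 h0 h2 h3 h4; omega
      · simp only [if_pos, if_neg k1, if_neg k3.symm] at g0 h0 h2 h3 h4; omega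
      · simp only [if_pos, if_neg k2, if_neg k3] at g0 h0 h2 h3 h4; omega
  refine ⟨W, ?_, hcyc⟩
  rw [hW, s2, Finset.card_insert_of_notMem (by simp [n7, n8, n9, n10]),
    Finset.card_insert_of_notMem (by simp [n1, n2, n3]),
    Finset.card_eq_three.2 ⟨x, y, z, n4, n5, n6, rfl⟩]
  omega

/-- A path of length two inside a class lengthens a triangle by two vertices. -/
theorem IsCompositionOver.exists_cyclicOn_of_path (hD : D.IsCompositionOver triangle c)
    (hsurj : Function.Surjective c) {j : ℕ} (hj : 1 ≤ j)
    (h : ∀ i, j + 1 ≤ (Finset.univ.filter fun y => c y = i).card) {x x' x'' : V} (hx : c x' = c x)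
    (hx' : c x'' = c x) (h12 : x'' ≠ x') (h23 : x' ≠ x) (h13 : x'' ≠ x)
    (hj2 : j + 2 ≤ (Finset.univ.filter fun y => c y = c x).card)
    (hxx : D.Adj x' x) (hxx' : D.Adj x'' x') :
    ∃ W : Finset V, W.card = 3 * j + 2 ∧ D.CyclicOn W := by
  obtain ⟨y, hy⟩ := hsurj (c x + 1)
  obtain ⟨z, hz⟩ := hsurj (c x + 1 + 1)
  obtain ⟨k1, k2, k3, k4⟩ := fin_three_add (c x)
  obtain ⟨τ, hτ, sτ, e1, e2, e3⟩ := hD.exists_triangle hy hz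
  have n2 : x' ≠ y := by rintro rfl; exact k1 (hx.symm.trans hy)
  have n3 : x' ≠ z := by rintro rfl; exact k2 (hx.symm.trans hz)
  have n4 : x ≠ y := by rintro rfl; exact k1 hy
  have n5 : x ≠ z := by rintro rfl; exact k2 hz
  have n6 : y ≠ z := by rintro rfl; exact k3 (hy.symm.trans hz)
  have n8 : x'' ≠ y := by rintro rfl; exact k1 (hx'.symm.trans hy)
  have n9 : x'' ≠ z := by rintro rfl; exact k2 (hx'.symm.trans hz)
  obtain ⟨τ₁, h1, s1, e1', -, f1⟩ := hτ.exists_insert (v := x') (x := z)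
    (by simp [sτ, h23, n2, n3]) (by simp [sτ]) (hD.adj_of_eq_add_one (by rw [hz, k4, hx]))
    (by rwa [e3])
  rw [sτ] at s1
  obtain ⟨τ₂, h2, s2, -, -, f2⟩ := h1.exists_insert (v := x'') (x := z)
    (by simp [s1, h12, h13, n8, n9]) (by simp [s1])
    (hD.adj_of_eq_add_one (by rw [hz, k4, hx'])) (by rwa [e1'])
  rw [s1] at s2
  obtain ⟨W, hW, hcyc⟩ := IsCyclePerm.exists_rounds hD (r := j - 1) h2 x (by simp [s2])
    (by rw [f2 x n5 h13.symm, f1 x n5 h23.symm, e1, hy]) fun i => by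
      have h1 := h i
      have g0 := card_filter_insert_le {x', x, y, z} x'' fun w => c w = i
      have h0 := card_filter_insert_le {x, y, z} x' fun w => c w = i
      have h2 := card_filter_insert_le {y, z} x fun w => c w = i
      have h3 := card_filter_insert_le {z} y fun w => c w = i
      have h4 := card_filter_insert_le ∅ z fun w => c w = i
      rw [← s2] at g0
      simp only [Finset.filter_empty, Finset.card_empty, hx, hx', hy, hz, insert_empty_eq]
        at g0 h0 h2 h3 h4
      rcases fin_three_cases (c x) i with rfl | rfl | rfl
      · simp only [if_pos, if_neg k1.symm, if_neg k2.symm] at g0 h0 h2 h3 h4; omega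
      · simp only [if_pos, if_neg k1, if_neg k3.symm] at g0 h0 h2 h3 h4; omega
      · simp only [if_pos, if_neg k2, if_neg k3] at g0 h0 h2 h3 h4; omega
  refine ⟨W, ?_, hcyc⟩
  rw [hW, s2, Finset.card_insert_of_notMem (by simp [h12, h13, n8, n9]),
    Finset.card_insert_of_notMem (by simp [h23, n2, n3]),
    Finset.card_eq_three.2 ⟨x, y, z, n4, n5, n6, rfl⟩]
  omega

/-- A Hamiltonian composition over the triangle is pancyclic, unless two classes are independent
and either the three classes have equal sizes, or there are at least five vertices and no class
contains a path of length two. -/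
theorem IsCompositionOver.hasCycleOfLength_of_triangle (hD : D.IsCompositionOver triangle c)
    (hlD : D.IsLoopless) (hsurj : Function.Surjective c) (hham : D.CyclicOn Finset.univ)
    (hex : ∀ i j, i ≠ j → D.IsIndependent {x | c x = i} → D.IsIndependent {x | c x = j} →
      ¬ (((Finset.univ.filter fun y => c y = 0).card = (Finset.univ.filter fun y => c y = 1).card ∧
        (Finset.univ.filter fun y => c y = 1).card = (Finset.univ.filter fun y => c y = 2).card) ∨
        (5 ≤ Fintype.card V ∧ ∀ i, ¬ D.HasPathOfLengthTwoIn {x | c x = i})))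
    {k : ℕ} (hk : 3 ≤ k) (hkn : k ≤ Fintype.card V) : D.HasCycleOfLength k := by
  obtain ⟨a₀, ha₀⟩ := hsurj 0
  obtain ⟨b₀, hb₀⟩ := hsurj 1
  obtain ⟨W, -, hW, hhit, hind, hlen⟩ := hD.exists_contraction rfl hham
    ⟨a₀, Finset.mem_univ _, b₀, Finset.mem_univ _, by rw [ha₀, hb₀]; decide⟩
  obtain ⟨σ, hσ, rfl⟩ := cyclicOn_iff.1 hW
  have hmle : ∀ i, mass c σ.support {i} ≤ mass c σ.support {i + 1} := fun i => by
    rw [← outNbr_triangle]; exact hσ.isFactor.mass_le _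
  -- on the contracted cycle all three classes have the same number `m` of vertices
  obtain ⟨m, hm⟩ : ∃ m, ∀ i, (σ.support.filter fun y => c y = i).card = m := by
    refine ⟨mass c σ.support {0}, fun i => ?_⟩
    rw [← mass_singleton_eq]
    have h0 := hmle 0
    have h1 := hmle 1
    have h2 := hmle 2
    simp only [Fin.isValue, zero_add, show (1 : Fin 3) + 1 = 2 from rfl,
      show (2 : Fin 3) + 1 = 0 from rfl] at h0 h1 h2
    fin_cases i <;> simp only [Fin.zero_eta, Fin.mk_one, Fin.reduceFinMk] <;> omega
  have hcardσ : σ.support.card = 3 * m := by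
    rw [← sum_card_filter c σ.support 0, hm, hm, hm]; ring
  rcases le_or_gt σ.support.card k with hle | hlt
  · exact hlen k hle (by rwa [Finset.card_univ])
  have hsub : ∀ i, (σ.support.filter fun y => c y = i) ⊆ Finset.univ.filter fun y => c y = i :=
    fun i => Finset.filter_subset_filter _ (Finset.subset_univ _)
  have hge : ∀ i, m ≤ (Finset.univ.filter fun y => c y = i).card := fun i => by
    rw [← hm i]; exact Finset.card_le_card (hsub i)
  -- independent classes are untouched by the contraction
  have hindep : ∀ i, D.IsIndependent {x | c x = i} →
      (Finset.univ.filter fun y => c y = i).card = m := by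
    intro i hi
    rw [← hm i]
    refine congrArg Finset.card (Finset.Subset.antisymm (fun x hx => ?_) (hsub i))
    have hxi := (Finset.mem_filter.1 hx).2
    refine Finset.mem_filter.2 ⟨?_, hxi⟩
    by_contra hxσ
    obtain ⟨y, hy, hxy⟩ := hind x (Finset.mem_univ _) hxσ
    exact hi x hxi y (hy.trans hxi) hxy
  have hdep : ∀ i, ¬ D.IsIndependent {x | c x = i} →
      ∃ x x', c x = i ∧ c x' = c x ∧ D.Adj x' x := by
    intro i hi
    simp only [IsIndependent, not_forall, not_not] at hi
    obtain ⟨x', hx', x, hx, hxx⟩ := hi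
    exact ⟨x, x', hx, hx'.trans hx.symm, hxx⟩
  obtain ⟨i, hi⟩ : ∃ i, ¬ D.IsIndependent {x | c x = i} := by
    by_contra! hcon
    refine hex 0 1 (by decide) (hcon 0) (hcon 1) (Or.inl ⟨?_, ?_⟩)
    · rw [hindep 0 (hcon 0), hindep 1 (hcon 1)]
    · rw [hindep 1 (hcon 1), hindep 2 (hcon 2)]
  rw [hasCycleOfLength_iff]
  obtain ⟨j, hj⟩ : ∃ j, k = 3 * j ∨ k = 3 * j + 1 ∨ k = 3 * j + 2 := ⟨k / 3, by omega⟩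
  obtain ⟨x, x', hx, hxx, hadj⟩ := hdep i hi
  rcases hj with rfl | rfl | rfl
  · exact hD.exists_cyclicOn_three_mul hsurj (by omega) fun i => by have := hge i; omega
  · exact hD.exists_cyclicOn_three_mul_add_one hlD hsurj (by omega)
      (fun i => by have := hge i; omega) hxx hadj
  have hge' : ∀ i, j + 1 ≤ (Finset.univ.filter fun y => c y = i).card := fun i => by
    have := hge i; omega
  by_cases h1 : D.IsIndependent {x | c x = i + 1}
  · by_cases h2 : D.IsIndependent {x | c x = i + 1 + 1}
    · have hnot := hex (i + 1) (i + 1 + 1) (fin_three_add i).2.2.1 h1 h2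
      rw [not_or, not_and] at hnot
      have e1 := hindep _ h1
      have e2 := hindep _ h2
      have hne : (Finset.univ.filter fun y => c y = i).card ≠ m := by
        intro hei
        have hall : ∀ l, (Finset.univ.filter fun y => c y = l).card = m := fun l => by
          rcases fin_three_cases i l with rfl | rfl | rfl <;> assumption
        exact hnot.1 (by rw [hall, hall]) (by rw [hall, hall])
      have hgt : m + 1 ≤ (Finset.univ.filter fun y => c y = i).card := by
        have := hge i; omega
      have hn := sum_card_filter c Finset.univ i
      rw [e1, e2, Finset.card_univ] at hn
      have h5 := hnot.2
      push Not at h5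
      obtain ⟨l, u, hu, v, hv, w, hw, huv, hvw, huw, huv', hvw'⟩ := h5 (by omega)
      have hli : l = i := by
        rcases fin_three_cases i l with rfl | rfl | rfl
        · rfl
        · exact absurd huv' (h1 u hu v hv)
        · exact absurd huv' (h2 u hu v hv)
      subst hli
      refine hD.exists_cyclicOn_of_path hsurj (by omega) hge' (x := w) (x' := v) (x'' := u)
        (Eq.trans hv hw.symm) (Eq.trans hu hw.symm) huv hvw huw ?_ hvw' huv'
      rw [show c w = l from hw]
      omega
    · obtain ⟨y, y', hy, hyy, hyadj⟩ := hdep _ h2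
      refine hD.exists_cyclicOn_three_mul_add_two hlD hsurj (by omega) hge' (x := y) (x' := y')
        (y := x') (y' := x) hyy hyadj ?_ hxx.symm hadj
      rw [hxx, hx, hy, (fin_three_add i).2.2.2]
  · obtain ⟨y, y', hy, hyy, hyadj⟩ := hdep _ h1
    exact hD.exists_cyclicOn_three_mul_add_two hlD hsurj (by omega) hge' (x := x) (x' := x')
      (y := y') (y' := y) hxx hadj (by rw [hyy, hy, hx]) hyy.symm hyadj

end Digraph

/-! ### Missing cycle lengths in exceptional triangular digraphs -/

namespace Digraph

section

variable {V : Type*} [Fintype V] [DecidableEq V] {D : Digraph V} {c : V → Fin 3}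

/-- On a cycle, two classes that are independent contain equally many vertices, and the third class
contains at least as many. -/
theorem IsCyclePerm.card_class (hD : D.IsCompositionOver triangle c) {τ : Perm V}
    (h : D.IsCyclePerm τ) {i : Fin 3} (h1 : D.IsIndependent {x | c x = i + 1})
    (h2 : D.IsIndependent {x | c x = i + 1 + 1}) :
    (τ.support.filter fun y => c y = i + 1 + 1).card =
      (τ.support.filter fun y => c y = i + 1).card ∧
    (τ.support.filter fun y => c y = i + 1).card ≤ (τ.support.filter fun y => c y = i).card := by
  have hpred : ∀ l, D.IsIndependent {x | c x = l + 1} →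
      (τ.support.filter fun y => c y = l + 1).card ≤ (τ.support.filter fun y => c y = l).card := by
    intro l hl
    refine Finset.card_le_card_of_injOn τ.symm (fun y hy => ?_) τ.symm.injective.injOn
    obtain ⟨hy, hyl⟩ := Finset.mem_filter.1 (Finset.mem_coe.1 hy)
    have hx : τ.symm y ∈ τ.support := by rwa [← apply_mem_support, apply_symm_apply]
    refine Finset.mem_coe.2 (Finset.mem_filter.2 ⟨hx, ?_⟩)
    have hadj := h.adj _ hx
    rw [apply_symm_apply] at hadj
    rcases hD.eq_or_eq_add_one hadj with h1 | h1
    · exact absurd hadj (hl _ (h1.symm.trans hyl) _ hyl)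
    · exact add_right_cancel (h1.symm.trans hyl)
  refine ⟨le_antisymm (hpred _ h2) ?_, hpred _ h1⟩
  refine Finset.card_le_card_of_injOn τ (fun x hx => ?_) τ.injective.injOn
  obtain ⟨hx, hxl⟩ := Finset.mem_filter.1 (Finset.mem_coe.1 hx)
  refine Finset.mem_coe.2 (Finset.mem_filter.2 ⟨apply_mem_support.2 hx, ?_⟩)
  rcases hD.eq_or_eq_add_one (h.adj x hx) with h3 | h3
  · exact absurd (h.adj x hx) (h1 _ hxl _ (h3.trans hxl))
  · rw [h3, hxl]

/-- If a class contains no path of length two, then on a cycle of length at least three each of its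
vertices is preceded or followed by a vertex of another class. Hence it contributes at most as many
vertices as the other two classes together. -/
theorem IsCyclePerm.card_class_le (hD : D.IsCompositionOver triangle c) {τ : Perm V}
    (h : D.IsCyclePerm τ) (h3 : 3 ≤ τ.support.card) {i : Fin 3}
    (hp : ¬ D.HasPathOfLengthTwoIn {x | c x = i}) :
    (τ.support.filter fun y => c y = i).card ≤
      (τ.support.filter fun y => c y = i + 1).card +
        (τ.support.filter fun y => c y = i + 1 + 1).card := by
  have hmem : ∀ {y}, y ∈ τ.support → τ.symm y ∈ τ.support := fun hy => by
    rwa [← apply_mem_support, apply_symm_apply]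
  have hsub : (τ.support.filter fun y => c y = i) ⊆
      ((τ.support.filter fun y => c y = i + 1).map τ.symm.toEmbedding) ∪
        ((τ.support.filter fun y => c y = i + 1 + 1).map τ.toEmbedding) := by
    intro y hy
    obtain ⟨hy, hyi⟩ := Finset.mem_filter.1 hy
    have hx := hmem hy
    have hadj := h.adj _ hx
    rw [apply_symm_apply] at hadj
    rw [Finset.mem_union, Finset.mem_map, Finset.mem_map]
    rcases hD.eq_or_eq_add_one (h.adj y hy) with h1 | h1
    · rcases hD.eq_or_eq_add_one hadj with h2 | h2
      · refine absurd
          ⟨_, h2.symm.trans hyi, y, hyi, _, h1.trans hyi, ?_, ?_, ?_, hadj, h.adj y hy⟩ hp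
        · intro h0
          exact mem_support.1 hx (by rw [apply_symm_apply]; exact h0.symm)
        · exact fun h0 => mem_support.1 hy h0.symm
        · intro h0
          exact h.apply_apply_ne h3 hx (by rw [apply_symm_apply]; exact h0.symm)
      · refine Or.inr ⟨_, Finset.mem_filter.2 ⟨hx, ?_⟩, by simp⟩
        have h4 := (fin_three_add i).2.2.2
        exact add_right_cancel (h2.symm.trans (hyi.trans h4.symm))
    · exact Or.inl ⟨τ y, Finset.mem_filter.2 ⟨apply_mem_support.2 hy, by rw [h1, hyi]⟩, by simp⟩
  have h4 := (Finset.card_le_card hsub).trans (Finset.card_union_le _ _)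
  rwa [Finset.card_map, Finset.card_map] at h4

theorem exists_of_ne_fin_three {i j : Fin 3} (hij : i ≠ j) {p : Fin 3 → Prop} (hi : p i)
    (hj : p j) : ∃ l, p (l + 1) ∧ p (l + 1 + 1) := by
  rcases fin_three_cases i j with rfl | rfl | rfl
  · exact absurd rfl hij
  · refine ⟨i + 1 + 1, ?_, ?_⟩ <;> rw [(fin_three_add i).2.2.2] <;> assumption
  · exact ⟨i + 1, hj, by rw [(fin_three_add i).2.2.2]; exact hi⟩

/-- If two classes are independent, then a cycle takes `j` vertices from each of them and at least
`j` from the third. For equal class sizes the length `n - 1` is impossible; if no class contains a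
path of length two, the length lies between `3 * j` and `4 * j`, so that it is not `5`. -/
theorem IsCompositionOver.not_isPancyclic (hD : D.IsCompositionOver triangle c)
    (hn : 4 ≤ Fintype.card V) {i j : Fin 3} (hij : i ≠ j) (hi : D.IsIndependent {x | c x = i})
    (hj : D.IsIndependent {x | c x = j})
    (hex : ((Finset.univ.filter fun y => c y = 0).card =
          (Finset.univ.filter fun y => c y = 1).card ∧
        (Finset.univ.filter fun y => c y = 1).card = (Finset.univ.filter fun y => c y = 2).card) ∨
        (5 ≤ Fintype.card V ∧ ∀ i, ¬ D.HasPathOfLengthTwoIn {x | c x = i})) :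
    ¬ D.IsPancyclic := by
  intro hpan
  obtain ⟨l, h1, h2⟩ := exists_of_ne_fin_three (p := fun i => D.IsIndependent {x | c x = i})
    hij hi hj
  rcases hex with ⟨e1, e2⟩ | ⟨h5, hp⟩
  · -- a cycle missing just one vertex would need equally many vertices from two classes
    obtain ⟨W, hW, hcyc⟩ := hasCycleOfLength_iff.1 (hpan (Fintype.card V - 1) (by
      have := sum_card_filter c Finset.univ 0
      rw [Finset.card_univ] at this
      simp only [zero_add, Fin.isValue, show (1 : Fin 3) + 1 = 2 from rfl] at this
      omega) (by omega))
    obtain ⟨τ, hτ, rfl⟩ := cyclicOn_iff.1 hcyc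
    obtain ⟨h3, h4⟩ := hτ.card_class hD h1 h2
    have h6 := sum_card_filter c τ.support l
    have h7 := sum_card_filter c Finset.univ l
    rw [Finset.card_univ] at h7
    have hle : ∀ i, (τ.support.filter fun y => c y = i).card ≤
        (Finset.univ.filter fun y => c y = i).card := fun i =>
      Finset.card_le_card (Finset.filter_subset_filter _ (Finset.subset_univ _))
    have hall : ∀ i, (Finset.univ.filter fun y => c y = i).card =
        (Finset.univ.filter fun y => c y = 0).card := by
      intro i
      fin_cases i
      exacts [rfl, e1.symm, (e1.trans e2).symm]
    have g0 := hle l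
    have g1 := hle (l + 1)
    rw [hall] at g0 g1
    rw [hall l, hall (l + 1), hall (l + 1 + 1)] at h7
    omega
  · obtain ⟨W, hW, hcyc⟩ := hasCycleOfLength_iff.1 (hpan 5 (by omega) h5)
    obtain ⟨τ, hτ, rfl⟩ := cyclicOn_iff.1 hcyc
    obtain ⟨h3, h4⟩ := hτ.card_class hD h1 h2
    have h6 := sum_card_filter c τ.support l
    have h7 := hτ.card_class_le hD (by omega) (hp l)
    omega

end

/-! ### The characterization -/

theorem isCompositionOver_composition {ι : Type*} {V : ι → Type*} {T : Digraph ι}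
    {H : ∀ i, Digraph (V i)} : (composition T H).IsCompositionOver T Sigma.fst := by
  intro a b hab
  change Sigma.Lex _ _ a b ↔ _
  rw [Sigma.lex_iff]
  exact ⟨fun h => h.resolve_right fun ⟨h, _⟩ => hab h, Or.inl⟩

theorem composition_isLoopless {ι : Type*} {V : ι → Type*} {T : Digraph ι}
    {H : ∀ i, Digraph (V i)} (hT : T.IsLoopless) (hH : ∀ i, (H i).IsLoopless) :
    (composition T H).IsLoopless := by
  intro a h
  rcases Sigma.lex_iff.1 h with h | ⟨h, h'⟩
  · exact hT _ h
  · exact hH _ _ h'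

/-- A triangular partition of the quotient lifts to the composition. -/
theorem IsCompositionOver.isTriangularWith_preimage {V ι : Type*} {D : Digraph V} {T : Digraph ι}
    {c : V → ι} (hD : D.IsCompositionOver T c) (hsurj : Function.Surjective c) {P : Fin 3 → Set ι}
    (h : T.IsTriangularWith P) : D.IsTriangularWith fun i => c ⁻¹' P i := by
  have hdom : ∀ {A B : Set ι}, T.StrictlyDominates A B →
      D.StrictlyDominates (c ⁻¹' A) (c ⁻¹' B) := by
    intro A B hAB a ha b hb
    have h1 := hAB _ ha _ hb
    have hne : c a ≠ c b := fun h0 => h1.2 (by rw [h0] at h1 ⊢; exact h1.1)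
    exact ⟨(hD a b hne).2 h1.1, fun h2 => h1.2 ((hD b a hne.symm).1 h2)⟩
  refine ⟨fun i => (h.nonempty i).preimage hsurj, fun i j hij => (h.disjoint i j hij).preimage c,
    ?_, hdom h.dom01, hdom h.dom12, hdom h.dom20⟩
  rw [← Set.preimage_iUnion, h.cover, Set.preimage_univ]

end Digraph

end

theorem mainTheorem4 {ι : Type*} [Fintype ι] {V : ι → Type*} [∀ i, Fintype (V i)]
    [∀ i, Nonempty (V i)] (T : Digraph ι) (H : ∀ i, Digraph (V i))
    (ht : 2 ≤ Fintype.card ι)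
    (hT : T.IsLoopless) (hH : ∀ i, (H i).IsLoopless)
    (hsemi : T.IsSemicomplete)
    (hnonbip : 3 ≤ Fintype.card ι ∨ ∃ i x y, (H i).Adj x y)
    (hn : 4 ≤ Fintype.card (Σ i, V i))
    (hham : (Digraph.composition T H).IsHamiltonian) :
    (Digraph.composition T H).IsPancyclic ↔
      ¬ ∃ P : Fin 3 → Set (Σ i, V i),
        (Digraph.composition T H).IsTriangularWith P ∧
        (∃ i j, i ≠ j ∧ (Digraph.composition T H).IsIndependent (P i) ∧
          (Digraph.composition T H).IsIndependent (P j)) ∧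
        (((P 0).ncard = (P 1).ncard ∧ (P 1).ncard = (P 2).ncard) ∨
          (5 ≤ Fintype.card (Σ i, V i) ∧
            ∀ i, ¬ (Digraph.composition T H).HasPathOfLengthTwoIn (P i))) := by
  classical
  have hncard : ∀ (c : (Σ i, V i) → Fin 3) i,
      {x | c x = i}.ncard = (Finset.univ.filter fun y => c y = i).card := fun c i => by
    rw [← Set.ncard_coe_finset]
    simp
  constructor
  · rintro hpan ⟨P, hP, ⟨i, j, hij, hi, hj⟩, hex⟩
    obtain ⟨c, hc, hD, -⟩ := hP.exists_class
    simp only [hc, hncard] at hi hj hex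
    exact hD.not_isPancyclic hn hij hi hj hex hpan
  · intro hno k hk hkn
    have hD := Digraph.isCompositionOver_composition (T := T) (H := H)
    have hlD := Digraph.composition_isLoopless hT hH
    have hsurj : Function.Surjective (Sigma.fst : (Σ i, V i) → ι) := fun i =>
      ⟨⟨i, Classical.arbitrary _⟩, rfl⟩
    by_cases htri : ∃ P : Fin 3 → Set (Σ i, V i), (Digraph.composition T H).IsTriangularWith P
    · obtain ⟨P, hP⟩ := htri
      obtain ⟨c, hc, hDc, hsc⟩ := hP.exists_class
      refine hDc.hasCycleOfLength_of_triangle hlD hsc hham.cyclicOn_univ ?_ hk hkn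
      intro i j hij hi hj hex
      refine hno ⟨P, hP, ⟨i, j, hij, ?_⟩, ?_⟩
      · simp only [hc]; exact ⟨hi, hj⟩
      · simp only [hc, hncard]; exact hex
    rcases Nat.lt_or_ge (Fintype.card ι) 3 with h3 | h3
    · obtain ⟨p, x, y, hxy⟩ := hnonbip.resolve_left (by omega)
      obtain ⟨a, b, hab, huniv⟩ := Finset.card_eq_two.1
        (show (Finset.univ : Finset ι).card = 2 by rw [Finset.card_univ]; omega)
      have hcov : ∀ i, i = a ∨ i = b := fun i => by
        have := Finset.mem_univ i
        rw [huniv] at this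
        simpa using this
      obtain ⟨q, hpq, hq⟩ : ∃ q, p ≠ q ∧ ∀ i, i = p ∨ i = q := by
        rcases hcov p with rfl | rfl
        exacts [⟨b, hab, hcov⟩, ⟨a, hab.symm, fun i => (hcov i).symm⟩]
      exact hD.hasCycleOfLength_of_two hlD hT hpq hq hsurj hham.cyclicOn_univ (x := ⟨p, x⟩)
        (y := ⟨p, y⟩) rfl rfl (Sigma.Lex.right x y hxy) hk hkn
    · exact hD.hasCycleOfLength hT hsemi h3 hsurj
        (fun ⟨P, hP⟩ => htri ⟨_, hD.isTriangularWith_preimage hsurj hP⟩) hham.cyclicOn_univ hk hkn
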